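/- Let $G$ be a finite simple graph with chromatic number $\chi(G)$. For a positive integer $k$, let $R_k(G)$ denote the graph whose vertices are the proper colorings of $G$ with colors from $\{1,\dots,k\}$, two colorings being adjacent if and only if they differ in color on exactly one vertex of $G$. Call $G$ recolorable if $R_\ell(G)$ is connected for every integer $\ell \ge \chi(G)+1$. Let $P_5$ be the path on five vertices, let the house be the five-vertex graph consisting of a cycle of length four together with one further vertex adjacent to exactly two consecutive vertices of the cycle, and let the bull be the five-vertex graph consisting of a triangle together with two further vertices of degree one attached to two distinct vertices of the triangle. If no induced subgraph of $G$ is isomorphic to $P_5$, to the house, or to the bull, then $G$ is recolorable. -/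

import Mathlib

namespace Recoloring

/-- The reconfiguration graph `R_k(G)`: its vertices are the proper colorings of `G` with colors
from a fixed set of `k` colors, and two colorings are adjacent if they differ in color on exactly
one vertex. -/
def reconfigurationGraph {V : Type*} (G : SimpleGraph V) (k : ℕ) :
    SimpleGraph (G.Coloring (Fin k)) where
  Adj α β := ∃! v : V, α v ≠ β v
  symm := ⟨fun α β h => by simpa only [ne_comm] using h⟩
  loopless := ⟨fun α h => by
    obtain ⟨v, hv, -⟩ := h
    exact hv rfl⟩

/-- `G` is `k`-mixing if `R_k(G)` is connected. -/
def IsMixing {V : Type*} (G : SimpleGraph V) (k : ℕ) : Prop :=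
  (reconfigurationGraph G k).Connected

/-- `G` is recolorable if it is `ℓ`-mixing for all `ℓ ≥ χ(G) + 1`. -/
def IsRecolorable {V : Type*} (G : SimpleGraph V) : Prop :=
  ∀ ℓ : ℕ, G.chromaticNumber + 1 ≤ (ℓ : ℕ∞) → IsMixing G ℓ

/-- `G` is `H`-free if no induced subgraph of `G` is isomorphic to `H`. -/
def IsInducedFree {V W : Type*} (G : SimpleGraph V) (H : SimpleGraph W) : Prop :=
  ¬ SimpleGraph.IsIndContained H G

/-- The house: the cycle `0, 1, 2, 3` together with a vertex `4` adjacent to `1` and `2`. -/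
def house : SimpleGraph (Fin 5) :=
  SimpleGraph.fromEdgeSet {s(0, 1), s(1, 2), s(2, 3), s(3, 0), s(4, 1), s(4, 2)}

/-- The bull: the triangle `0, 3, 4` together with a vertex `1` adjacent only to `0` and a
vertex `2` adjacent only to `3`. -/
def bull : SimpleGraph (Fin 5) :=
  SimpleGraph.fromEdgeSet {s(0, 3), s(3, 4), s(4, 0), s(0, 1), s(3, 2)}

end Recoloring

/-! The proof is by induction on the number of vertices, for the statement that the colorings with
`k + 1` colors are connected to each other whenever `G` is `k`-colorable. Allowing every such `k`,
not only the chromatic number, lets `k` stay fixed when `G` is replaced by a smaller graph.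

If some proper module `M` is not a clique, replace it by a clique with as many vertices as the
chromatic number of `G[M]`. This graph is smaller, and it stays in the class because `P₅`, the house
and the bull have no true twins. By `MixesAboveChromatic.of_module`, recoloring sequences of `G[M]`
and of the replaced graph combine to sequences of `G`.

If every proper module is a clique, then `G` has a simplicial vertex or no three independent
vertices (`exists_simplicial_or_noIndependentTriple`). An induced `C₅` makes `G` a blow-up of `C₅`
by cliques, so there is no independent triple. Without induced `C₄` and `C₅`, a vertex of minimum
degree is simplicial. An induced `C₄` without induced `C₅` is enlarged to a maximal pair of
anticonnected sets complete to each other, and a vertex mixed on one of them is simplicial.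

A simplicial vertex has degree less than `k` and can be deleted. Without independent triples, color
classes have size at most two; any coloring can be moved to one with the same classes as a fixed
optimal coloring, and what remains is to recolor a complete graph. -/

namespace Recoloring

/-! ### Recoloring sequences: pulling back, lifting, deleting a vertex -/

variable {V W : Type*} {G : SimpleGraph V} {H : SimpleGraph W} {l : ℕ}

/-- For every `k` such that `G` is `k`-colorable, any two `(k + 1)`-colorings of `G` are joined by
a path of the reconfiguration graph. -/
def MixesAboveChromatic (G : SimpleGraph V) : Prop :=
  ∀ k : ℕ, G.Colorable k → (reconfigurationGraph G (k + 1)).Preconnected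

theorem isRecolorable_of_mixesAboveChromatic (h : MixesAboveChromatic G) : IsRecolorable G := by
  intro l hl
  obtain ⟨k, rfl⟩ : ∃ k, l = k + 1 := by
    refine Nat.exists_eq_succ_of_ne_zero ?_
    rintro rfl
    simp at hl
  have hc : G.chromaticNumber ≤ (k : ℕ∞) := by
    push_cast at hl
    exact (ENat.add_le_add_iff_right (by simp)).1 hl
  have hk : G.Colorable k := SimpleGraph.chromaticNumber_le_iff_colorable.1 hc
  have : Nonempty (G.Coloring (Fin (k + 1))) := hk.mono (Nat.le_succ k)
  exact ⟨h k hk⟩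

theorem reachable_of_eq_off {α β : G.Coloring (Fin l)} (v : V) (h : ∀ w, w ≠ v → α w = β w) :
    (reconfigurationGraph G l).Reachable α β := by
  by_cases hv : α v = β v
  · have : α = β := by
      ext w
      by_cases hw : w = v
      · rw [hw, hv]
      · rw [h w hw]
    rw [this]
  · refine SimpleGraph.Adj.reachable ⟨v, hv, fun w hw => ?_⟩
    by_contra hne
    exact hw (h w hne)

theorem eq_off_of_adj {α β : G.Coloring (Fin l)} (h : (reconfigurationGraph G l).Adj α β) :
    ∃ v, ∀ w, w ≠ v → α w = β w := by
  obtain ⟨v, -, hv⟩ := h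
  exact ⟨v, fun w hw => by_contra fun hne => hw (hv w hne)⟩

open Classical in
/-- The coloring `α` with the color of `v` changed to `c`. -/
noncomputable def recolor (α : G.Coloring (Fin l)) (v : V) (c : Fin l)
    (h : ∀ w, G.Adj v w → α w ≠ c) : G.Coloring (Fin l) :=
  SimpleGraph.Coloring.mk (fun w => if w = v then c else α w) (by
    intro a b hab
    split_ifs with h1 h2 h2
    · subst h1 h2; exact absurd hab (G.loopless.irrefl _)
    · subst h1; exact (h b hab).symm
    · subst h2; exact h a hab.symm
    · exact α.valid hab)

theorem recolor_self (α : G.Coloring (Fin l)) (v : V) (c : Fin l)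
    (h : ∀ w, G.Adj v w → α w ≠ c) : recolor α v c h v = c :=
  if_pos rfl

theorem recolor_of_ne (α : G.Coloring (Fin l)) (v : V) (c : Fin l)
    (h : ∀ w, G.Adj v w → α w ≠ c) {w : V} (hw : w ≠ v) : recolor α v c h w = α w :=
  if_neg hw

theorem reachable_recolor (α : G.Coloring (Fin l)) (v : V) (c : Fin l)
    (h : ∀ w, G.Adj v w → α w ≠ c) :
    (reconfigurationGraph G l).Reachable α (recolor α v c h) :=
  reachable_of_eq_off v fun _ hw => (recolor_of_ne α v c h hw).symm

/-- Two colorings that differ on an independent set only are joined by a path. -/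
theorem reachable_of_independent [Finite V] {α β : G.Coloring (Fin l)}
    (h : ∀ u v, α u ≠ β u → α v ≠ β v → ¬ G.Adj u v) :
    (reconfigurationGraph G l).Reachable α β := by
  classical
  have := Fintype.ofFinite V
  obtain ⟨n, hn⟩ : ∃ n, (Finset.univ.filter fun v => α v ≠ β v).card = n := ⟨_, rfl⟩
  induction n using Nat.strong_induction_on generalizing α with
  | _ n ih =>
    by_cases hex : ∃ v, α v ≠ β v
    · obtain ⟨v, hv⟩ := hex
      -- The neighbors of `v` already have their final colors, so `β v` is not among them.
      have hc : ∀ w, G.Adj v w → α w ≠ β v := by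
        intro w hw
        have : α w = β w := by_contra fun hne => h v w hv hne hw
        rw [this]
        exact (β.valid hw).symm
      have hsub : ∀ w, recolor α v (β v) hc w ≠ β w → w ≠ v ∧ α w ≠ β w := by
        intro w hw
        have hwv : w ≠ v := by
          rintro rfl
          exact hw (recolor_self _ _ _ hc)
        rw [recolor_of_ne _ _ _ hc hwv] at hw
        exact ⟨hwv, hw⟩
      refine (reachable_recolor α v (β v) hc).trans (ih _ ?_ ?_ rfl)
      · rw [← hn]
        refine Finset.card_lt_card ⟨fun w hw => ?_, fun hle => ?_⟩
        · rw [Finset.mem_filter] at hw ⊢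
          exact ⟨hw.1, (hsub w hw.2).2⟩
        · have := hle (Finset.mem_filter.2 ⟨Finset.mem_univ v, hv⟩)
          exact (hsub v (Finset.mem_filter.1 this).2).1 rfl
      · exact fun a b ha hb => h a b (hsub a ha).2 (hsub b hb).2
    · push Not at hex
      have : α = β := by
        ext w
        rw [hex w]
      rw [this]

/-- The coloring of `G` obtained from a coloring of `H` along a homomorphism. -/
def pullback (δ : H.Coloring (Fin l)) (φ : G →g H) : G.Coloring (Fin l) :=
  SimpleGraph.Coloring.mk (fun x => δ (φ x)) fun h => δ.valid (φ.map_adj h)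

theorem pullback_apply (δ : H.Coloring (Fin l)) (φ : G →g H) (x : V) :
    pullback δ φ x = δ (φ x) := rfl

/-- Recoloring sequences pull back along graph homomorphisms. -/
theorem reachable_pullback [Finite V] {δ δ' : H.Coloring (Fin l)}
    (h : (reconfigurationGraph H l).Reachable δ δ') (φ : G →g H) :
    (reconfigurationGraph G l).Reachable (pullback δ φ) (pullback δ' φ) := by
  obtain ⟨p⟩ := h
  induction p with
  | nil => rfl
  | cons hadj _ ih =>
    -- A step that recolors one vertex `x` of `H` changes the pullback only on the fiber of `x`,
    -- which is independent because `H` has no loops.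
    refine SimpleGraph.Reachable.trans (reachable_of_independent ?_) ih
    obtain ⟨x, hx⟩ := eq_off_of_adj hadj
    intro u v hu hv huv
    have h1 : φ u = x := by_contra fun hne => hu (hx _ hne)
    have h2 : φ v = x := by_contra fun hne => hv (hx _ hne)
    have := φ.map_adj huv
    rw [h1, h2] at this
    exact H.loopless.irrefl _ this

/-- A recoloring sequence of the subgraph induced by `M` lifts to `G` if the colors that it uses do
not appear on the neighbors of `M`. -/
theorem reachable_of_induce {M : Set V} {j : ℕ} (e : Fin j ↪ Fin l)
    {a b : (G.induce M).Coloring (Fin j)} (h : (reconfigurationGraph (G.induce M) j).Reachable a b)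
    {α β : G.Coloring (Fin l)} (hα : ∀ x : M, α x = e (a x)) (hβ : ∀ x : M, β x = e (b x))
    (hoff : ∀ x, x ∉ M → α x = β x)
    (hN : ∀ x, x ∉ M → ∀ y ∈ M, G.Adj x y → ∀ i, α x ≠ e i) :
    (reconfigurationGraph G l).Reachable α β := by
  classical
  obtain ⟨p⟩ := h
  induction p generalizing α with
  | nil =>
    have : α = β := by
      ext x
      by_cases hx : x ∈ M
      · rw [hα ⟨x, hx⟩, hβ ⟨x, hx⟩]
      · rw [hoff x hx]
    rw [this]
  | @cons a a' b hadj _ ih =>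
    let α' : G.Coloring (Fin l) := SimpleGraph.Coloring.mk
      (fun x => if hx : x ∈ M then e (a' ⟨x, hx⟩) else α x) (by
        intro x y hxy
        split_ifs with h1 h2 h2
        · exact fun he => a'.valid (v := ⟨x, h1⟩) (w := ⟨y, h2⟩) hxy (e.injective he)
        · exact (hN y h2 x h1 hxy.symm _).symm
        · exact hN x h1 y h2 hxy _
        · exact α.valid hxy)
    have hin : ∀ x : M, α' x = e (a' x) := fun x => dif_pos x.2
    have hout : ∀ x, x ∉ M → α' x = α x := fun x hx => dif_neg hx
    refine SimpleGraph.Reachable.trans ?_ (ih (α := α') hin hβ (fun x hx => ?_) ?_)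
    · obtain ⟨v, hv⟩ := eq_off_of_adj hadj
      refine reachable_of_eq_off v.1 fun w hw => ?_
      by_cases hM : w ∈ M
      · rw [hα ⟨w, hM⟩, hin ⟨w, hM⟩, hv ⟨w, hM⟩ (fun h => hw (congrArg Subtype.val h))]
      · rw [hout w hM]
    · rw [hout x hx, hoff x hx]
    · intro x hx y hy hxy i
      rw [hout x hx]
      exact hN x hx y hy hxy i

/-- A vertex of small degree can be deleted. -/
theorem preconnected_of_degree_lt [Finite V] {k : ℕ} (u : V) (hdeg : (G.neighborSet u).ncard < k)
    (h : (reconfigurationGraph (G.induce {v | v ≠ u}) (k + 1)).Preconnected) :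
    (reconfigurationGraph G (k + 1)).Preconnected := by
  classical
  have := Fintype.ofFinite V
  let res : G.Coloring (Fin (k + 1)) → (G.induce {v | v ≠ u}).Coloring (Fin (k + 1)) :=
    fun α => pullback α (SimpleGraph.Embedding.induce _).toHom
  have hres : ∀ (α : G.Coloring (Fin (k + 1))) (x : ({v | v ≠ u} : Set V)), res α x = α x :=
    fun α x => rfl
  -- A sequence of `G - u` lifts to `G`: before each step, `u` moves out of the way. At most `k - 1`
  -- colors of neighbors and one new color must be avoided, out of `k + 1`.
  have key : ∀ (δ δ' : (G.induce {v | v ≠ u}).Coloring (Fin (k + 1))),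
      (reconfigurationGraph (G.induce {v | v ≠ u}) (k + 1)).Reachable δ δ' →
      ∀ α : G.Coloring (Fin (k + 1)), res α = δ → ∃ α' : G.Coloring (Fin (k + 1)),
        res α' = δ' ∧ (reconfigurationGraph G (k + 1)).Reachable α α' := by
    rintro δ δ' ⟨p⟩
    induction p with
    | nil => exact fun α hα => ⟨α, hα, SimpleGraph.Reachable.refl _⟩
    | @cons δ ε δ' hadj _ ih =>
      intro α hα
      suffices hs : ∃ α' : G.Coloring (Fin (k + 1)), res α' = ε ∧
          (reconfigurationGraph G (k + 1)).Reachable α α' by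
        obtain ⟨α', h1, h2⟩ := hs
        obtain ⟨α'', h3, h4⟩ := ih α' h1
        exact ⟨α'', h3, h2.trans h4⟩
      obtain ⟨v, hv⟩ := eq_off_of_adj hadj
      have hαδ : ∀ x (hx : x ≠ u), α x = δ ⟨x, hx⟩ := fun x hx => by rw [← hα]; rfl
      -- a color for `u` that avoids the old colors of its neighbors and the new color of `v`
      obtain ⟨c, hc⟩ : ∃ c : Fin (k + 1),
          c ∉ insert (ε v) ((G.neighborFinset u).image α) := by
        by_contra hall
        push Not at hall
        have h1 : (Finset.univ : Finset (Fin (k + 1))) ⊆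
            insert (ε v) ((G.neighborFinset u).image α) := fun c _ => hall c
        have h2 := Finset.card_le_card h1
        have h3 := Finset.card_insert_le (ε v) ((G.neighborFinset u).image α)
        have h4 : ((G.neighborFinset u).image α).card ≤ (G.neighborFinset u).card :=
          Finset.card_image_le
        have h5 : (G.neighborFinset u).card = (G.neighborSet u).ncard := by
          rw [Set.ncard_eq_toFinset_card', SimpleGraph.neighborFinset]
        rw [Finset.card_univ, Fintype.card_fin] at h2
        omega
      rw [Finset.mem_insert, not_or, Finset.mem_image] at hc
      have hc' : ∀ w, G.Adj u w → α w ≠ c := fun w hw he =>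
        hc.2 ⟨w, by simpa using hw, he⟩
      have hvu : (v : V) ≠ u := v.2
      have hcol : ∀ w, G.Adj v.1 w → recolor α u c hc' w ≠ ε v := by
        intro w hw
        by_cases hwu : w = u
        · subst hwu
          rw [recolor_self]
          exact hc.1
        · rw [recolor_of_ne _ _ _ _ hwu, hαδ w hwu,
            hv ⟨w, hwu⟩ (fun h => G.ne_of_adj hw (congrArg Subtype.val h).symm)]
          exact (ε.valid (v := v) (w := ⟨w, hwu⟩) hw).symm
      refine ⟨recolor (recolor α u c hc') v (ε v) hcol, ?_,
        (reachable_recolor α u c hc').trans (reachable_recolor _ _ _ _)⟩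
      ext x
      rw [hres]
      by_cases hx : x = v
      · rw [hx, recolor_self]
      · rw [recolor_of_ne _ _ _ _ (fun h => hx (Subtype.ext h)), recolor_of_ne _ _ _ _ x.2,
          hαδ x x.2, hv x hx]
  intro α β
  obtain ⟨α', h1, h2⟩ := key _ _ (h (res α) (res β)) α rfl
  refine h2.trans (reachable_of_eq_off u fun w hw => ?_)
  have := DFunLike.congr_fun h1 (⟨w, hw⟩ : ({v | v ≠ u} : Set V))
  rwa [hres, hres] at this

/-- A vertex is simplicial if its neighborhood is a clique. -/
def IsSimplicial (G : SimpleGraph V) (u : V) : Prop :=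
  ∀ x y, G.Adj u x → G.Adj u y → x ≠ y → G.Adj x y

/-- The closed neighborhood is a clique with one vertex more than the degree of `u`. -/
theorem IsSimplicial.degree_lt [Finite V] {u : V} (hu : IsSimplicial G u) {k : ℕ}
    (hk : G.Colorable k) : (G.neighborSet u).ncard < k := by
  classical
  have := Fintype.ofFinite V
  have hclique : G.IsClique (insert u (G.neighborFinset u) : Finset V) := by
    intro x hx y hy hxy
    simp only [Finset.coe_insert, Set.mem_insert_iff, Finset.mem_coe,
      SimpleGraph.mem_neighborFinset] at hx hy
    rcases hx with rfl | hx <;> rcases hy with rfl | hy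
    · exact absurd rfl hxy
    · exact hy
    · exact hx.symm
    · exact hu x y hx hy hxy
  have h1 := hclique.card_le_of_colorable hk
  rw [Finset.card_insert_of_notMem (by simp)] at h1
  have h5 : (G.neighborFinset u).card = (G.neighborSet u).ncard := by
    rw [Set.ncard_eq_toFinset_card', SimpleGraph.neighborFinset]
  omega

theorem MixesAboveChromatic.of_simplicial [Finite V] {u : V} (hu : IsSimplicial G u)
    (h : MixesAboveChromatic (G.induce {v | v ≠ u})) : MixesAboveChromatic G := by
  intro k hk
  exact preconnected_of_degree_lt u (hu.degree_lt hk)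
    (h k (hk.of_hom (SimpleGraph.Embedding.induce _).toHom))

/-- Complete graphs. -/
theorem mixesAboveChromatic_of_complete {n : ℕ} : ∀ {U : Type*} [Finite U] (K : SimpleGraph U),
    Nat.card U = n → (∀ x y, x ≠ y → K.Adj x y) → MixesAboveChromatic K := by
  induction n with
  | zero =>
    intro U _ K hU _ k _ α β
    have : IsEmpty U := (Nat.card_eq_zero.1 hU).resolve_right (fun h => h.not_finite ‹_›)
    rw [show α = β from DFunLike.ext _ _ fun x => isEmptyElim x]
  | succ n ih =>
    intro U _ K hU hK
    have : Nonempty U := (Nat.card_pos_iff.1 (by omega)).1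
    obtain ⟨u⟩ := ‹Nonempty U›
    refine MixesAboveChromatic.of_simplicial (u := u) (fun x y _ _ hxy => hK x y hxy) ?_
    refine ih _ ?_ fun x y hxy => hK _ _ (fun h => hxy (Subtype.ext h))
    have h1 := Set.ncard_add_ncard_compl ({u} : Set U)
    rw [Set.ncard_singleton, hU] at h1
    have h2 : ({u}ᶜ : Set U) = {v | v ≠ u} := rfl
    rw [h2, ← Nat.card_coe_set_eq] at h1
    omega

end Recoloring

/-! ### Modules and their replacement by cliques -/

namespace Recoloring

variable {V : Type*} {G : SimpleGraph V}

/-- A set of vertices is a module if no vertex outside distinguishes two of its elements. -/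
def IsModule (G : SimpleGraph V) (M : Set V) : Prop :=
  ∀ v ∉ M, ∀ a ∈ M, ∀ b ∈ M, G.Adj v a → G.Adj v b

/-- The graph obtained from `G` by replacing the module `M`, represented by its element `r`, with a
complete graph on `m` vertices. -/
def replaceByClique (G : SimpleGraph V) (M : Set V) (r : V) (m : ℕ) :
    SimpleGraph ({x // x ∉ M} ⊕ Fin m) where
  Adj
    | .inl x, .inl y => G.Adj x y
    | .inl x, .inr _ => G.Adj x r
    | .inr _, .inl y => G.Adj y r
    | .inr i, .inr j => i ≠ j
  symm := ⟨by
    rintro (x | i) (y | j) h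
    · exact SimpleGraph.Adj.symm h
    · exact h
    · exact h
    · exact Ne.symm h⟩
  loopless := ⟨by
    rintro (x | i) h
    · exact G.loopless.irrefl _ h
    · exact h rfl⟩

open Classical in
/-- A coloring of the subgraph induced by a module gives a homomorphism to the graph in which the
module is replaced by a complete graph on the set of colors. -/
noncomputable def collapse {M : Set V} (hM : IsModule G M) {r : V} (hr : r ∈ M) {m : ℕ}
    (c : (G.induce M).Coloring (Fin m)) : G →g replaceByClique G M r m where
  toFun x := if h : x ∈ M then .inr (c ⟨x, h⟩) else .inl ⟨x, h⟩
  map_rel' := by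
    intro x y hxy
    by_cases hx : x ∈ M <;> by_cases hy : y ∈ M
    · simp only [hx, hy, dif_pos]
      exact c.valid (v := ⟨x, hx⟩) (w := ⟨y, hy⟩) hxy
    · simp only [hx, hy, dif_pos, dif_neg, not_false_iff]
      exact hM y hy x hx r hr hxy.symm
    · simp only [hx, hy, dif_pos, dif_neg, not_false_iff]
      exact hM x hx y hy r hr hxy
    · simp only [hx, hy, dif_neg, not_false_iff]
      exact hxy

section
variable {M : Set V} {r : V} {m l : ℕ}

theorem collapse_of_mem (hM : IsModule G M) (hr : r ∈ M) (c : (G.induce M).Coloring (Fin m))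
    (x : M) : collapse hM hr c x = .inr (c x) := dif_pos x.2

theorem collapse_of_notMem (hM : IsModule G M) (hr : r ∈ M) (c : (G.induce M).Coloring (Fin m))
    {x : V} (hx : x ∉ M) :
    collapse hM hr c x = .inl ⟨x, hx⟩ := dif_neg hx

/-- The coloring of `replaceByClique G M r m` that agrees with `α` outside of `M` and is given by
`f` on the complete graph. -/
def replaceColoring (α : G.Coloring (Fin l)) (f : Fin m → Fin l)
    (hf : Function.Injective f) (hN : ∀ x ∉ M, G.Adj x r → ∀ i, α x ≠ f i) :
    (replaceByClique G M r m).Coloring (Fin l) :=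
  SimpleGraph.Coloring.mk (Sum.elim (fun x => α x.1) f) (by
    rintro (x | i) (y | j) h
    · exact α.valid h
    · exact hN x x.2 h j
    · exact (hN y y.2 h i).symm
    · exact hf.ne h)

open Classical in
/-- The set of colors of a coloring on a set of vertices. -/
noncomputable def colorsOn (α : G.Coloring (Fin l)) (M : Set V) : Finset (Fin l) :=
  Finset.univ.filter fun i => ∃ x ∈ M, α x = i

theorem mem_colorsOn {α : G.Coloring (Fin l)} {i : Fin l} :
    i ∈ colorsOn α M ↔ ∃ x ∈ M, α x = i := by
  simp [colorsOn]

/-- The coloring induced on `M`, with its colors numbered from zero. -/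
theorem exists_coloring_on (α : G.Coloring (Fin l)) (M : Set V) {j : ℕ}
    (hj : (colorsOn α M).card = j) :
    ∃ (a : (G.induce M).Coloring (Fin j)) (e : Fin j ↪ Fin l),
      (∀ x : M, α x = e (a x)) ∧ ∀ i, ∃ x ∈ M, α x = e i := by
  let E : Fin j ≃ colorsOn α M := ((colorsOn α M).equivFinOfCardEq hj).symm
  refine ⟨SimpleGraph.Coloring.mk
    (fun x => E.symm ⟨α x, mem_colorsOn.2 ⟨x, x.2, rfl⟩⟩) ?_,
    E.toEmbedding.trans (Function.Embedding.subtype _), ?_, ?_⟩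
  · intro x y hxy he
    have := congrArg Subtype.val (E.symm.injective he)
    exact α.valid (v := x.1) (w := y.1) hxy this
  · intro x
    change α x = (E (E.symm _)).1
    rw [E.apply_symm_apply]
  · intro i
    exact mem_colorsOn.1 (E i).2

theorem color_ne_of_adj_module (hM : IsModule G M)
    {α : G.Coloring (Fin l)} {c : Fin l} (hc : ∃ x ∈ M, α x = c)
    {x : V} (hx : x ∉ M) {y : V} (hy : y ∈ M) (h : G.Adj x y) : α x ≠ c := by
  obtain ⟨z, hz, rfl⟩ := hc
  exact α.valid (hM x hx y hy z hz h)

/-- Replacing a module by a complete graph on as many vertices as its chromatic number. -/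
theorem MixesAboveChromatic.of_module [Finite V] (hM : IsModule G M) (hr : r ∈ M)
    (hm : (G.induce M).Colorable m) (hmin : ∀ j, (G.induce M).Colorable j → m ≤ j)
    (hMix : MixesAboveChromatic (G.induce M))
    (hRep : MixesAboveChromatic (replaceByClique G M r m)) : MixesAboveChromatic G := by
  classical
  intro k hk
  obtain ⟨c₀⟩ := hm
  have hcard : ∀ {l : ℕ} (α : G.Coloring (Fin l)), m ≤ (colorsOn α M).card := fun α => by
    obtain ⟨a, -⟩ := exists_coloring_on α M rfl
    exact hmin _ ⟨a⟩
  -- an arbitrary coloring can be brought to one that is optimal on `M`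
  have step : ∀ α : G.Coloring (Fin (k + 1)), ∃ (c : (G.induce M).Coloring (Fin m))
      (δ : (replaceByClique G M r m).Coloring (Fin (k + 1))),
      (reconfigurationGraph G (k + 1)).Reachable α
        (pullback δ (collapse hM hr c)) := by
    intro α
    -- With exactly `m` colors on `M`, `α` is itself a pullback. With `j + 1 > m` colors, `G[M]` is
    -- `j`-colorable, so it can be recolored to `c₀` within those `j + 1` colors; as `M` is a
    -- module, none of them occurs on a neighbor of `M`.
    rcases (hcard α).eq_or_lt with hj | hj
    · obtain ⟨a, e, hae, he⟩ := exists_coloring_on α M hj.symm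
      refine ⟨a, replaceColoring α e e.injective
        (fun x hx hxr i => color_ne_of_adj_module hM (he i) hx hr hxr), ?_⟩
      convert SimpleGraph.Reachable.refl α using 1
      ext x
      by_cases hx : x ∈ M
      · rw [hae ⟨x, hx⟩, pullback_apply, collapse_of_mem hM hr a ⟨x, hx⟩]
        rfl
      · rw [pullback_apply, collapse_of_notMem hM hr a hx]
        rfl
    · obtain ⟨j, hj'⟩ : ∃ j, (colorsOn α M).card = j + 1 :=
        Nat.exists_eq_succ_of_ne_zero (by omega)
      obtain ⟨a, e, hae, he⟩ := exists_coloring_on α M hj'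
      have hmj : m ≤ j := by omega
      have hmj' : m ≤ j + 1 := by omega
      let b : (G.induce M).Coloring (Fin (j + 1)) :=
        SimpleGraph.Coloring.mk (fun x => Fin.castLE hmj' (c₀ x))
          (fun {x y} hxy h => c₀.valid hxy (Fin.castLE_injective hmj' h))
      have hN : ∀ x ∉ M, ∀ y ∈ M, G.Adj x y → ∀ i, α x ≠ e i :=
        fun x hx y hy hxy i => color_ne_of_adj_module hM (he i) hx hy hxy
      refine ⟨c₀, replaceColoring α (fun i => e (Fin.castLE hmj' i))
        (e.injective.comp (Fin.castLE_injective hmj'))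
        (fun x hx hxr i => hN x hx r hr hxr _), ?_⟩
      refine reachable_of_induce e (hMix j (SimpleGraph.Colorable.mono hmj ⟨c₀⟩) a b) hae ?_ ?_ hN
      · intro x
        rw [pullback_apply, collapse_of_mem hM hr c₀ x]
        rfl
      · intro x hx
        rw [pullback_apply, collapse_of_notMem hM hr c₀ hx]
        rfl
  -- a coloring of the replaced graph that leaves one color free
  obtain ⟨α₀⟩ := hk
  obtain ⟨a₀, e₀, -, he₀⟩ := exists_coloring_on α₀ M rfl
  -- A `k`-coloring of `G` has at least `m` colors on `M`; `m` of them color the clique.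
  let f₀ : Fin m → Fin k := fun i => e₀ (Fin.castLE (hcard α₀) i)
  have hf₀ : Function.Injective f₀ := e₀.injective.comp (Fin.castLE_injective _)
  let δ₀ : (replaceByClique G M r m).Coloring (Fin k) := replaceColoring α₀ f₀ hf₀
    (fun x hx hxr i => color_ne_of_adj_module hM (he₀ _) hx hr hxr)
  let δ₁ : (replaceByClique G M r m).Coloring (Fin (k + 1)) :=
    SimpleGraph.Coloring.mk (fun x => Fin.castSucc (δ₀ x))
      (fun {x y} hxy h => δ₀.valid hxy (Fin.castSucc_injective _ h))
  let e : Fin (m + 1) ↪ Fin (k + 1) :=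
    ⟨Fin.snoc (α := fun _ => Fin (k + 1)) (fun i => Fin.castSucc (f₀ i)) (Fin.last k), by
      refine Fin.snoc_injective_iff.2 ⟨(Fin.castSucc_injective k).comp hf₀, ?_⟩
      rintro ⟨i, hi⟩
      exact (Fin.castSucc_lt_last _).ne hi⟩
  have he_cast : ∀ i : Fin m, e i.castSucc = Fin.castSucc (f₀ i) := fun i =>
    Fin.snoc_castSucc (α := fun _ => Fin (k + 1)) (Fin.last k) (fun i => Fin.castSucc (f₀ i)) i
  have he_last : e (Fin.last m) = Fin.last k :=
    Fin.snoc_last (α := fun _ => Fin (k + 1)) (Fin.last k) (fun i => Fin.castSucc (f₀ i))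
  -- The color `Fin.last k` is unused by `δ₁`, so `M` has `m + 1` colors at its disposal, enough to
  -- pass from one optimal coloring of `G[M]` to another.
  have change : ∀ c c' : (G.induce M).Coloring (Fin m),
      (reconfigurationGraph G (k + 1)).Reachable
        (pullback δ₁ (collapse hM hr c))
        (pullback δ₁ (collapse hM hr c')) := by
    intro c c'
    let up : (G.induce M).Coloring (Fin m) → (G.induce M).Coloring (Fin (m + 1)) := fun c =>
      SimpleGraph.Coloring.mk (fun x => Fin.castSucc (c x))
        (fun {x y} hxy h => c.valid hxy (Fin.castSucc_injective _ h))
    have hup : ∀ (c : (G.induce M).Coloring (Fin m)) (x : M),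
        (pullback δ₁ (collapse hM hr c)) x =
          e (up c x) := by
      intro c x
      rw [pullback_apply, collapse_of_mem hM hr c x]
      exact (he_cast _).symm
    have hoff : ∀ (c : (G.induce M).Coloring (Fin m)) {x : V} (hx : x ∉ M),
        (pullback δ₁ (collapse hM hr c)) x =
          Fin.castSucc (α₀ x) := by
      intro c x hx
      rw [pullback_apply, collapse_of_notMem hM hr c hx]
      rfl
    refine reachable_of_induce e (hMix m ⟨c⟩ (up c) (up c')) (hup c) (hup c') ?_ ?_
    · intro x hx
      rw [hoff c hx, hoff c' hx]
    · intro x hx y hy hxy i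
      rw [hoff c hx]
      induction i using Fin.lastCases with
      | last => rw [he_last]; exact (Fin.castSucc_lt_last _).ne
      | cast i =>
        rw [he_cast]
        exact fun h => color_ne_of_adj_module hM (he₀ _) hx hy hxy
          (Fin.castSucc_injective _ h)
  have main : ∀ α : G.Coloring (Fin (k + 1)), (reconfigurationGraph G (k + 1)).Reachable α
      (pullback δ₁ (collapse hM hr c₀)) := by
    intro α
    obtain ⟨c, δ, h⟩ := step α
    exact (h.trans (reachable_pullback (hRep k ⟨δ₀⟩ δ δ₁) (collapse hM hr c))).trans (change c c₀)
  exact fun α β => (main α).trans (main β).symm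

end

/-- `F` has two true twins, that is, adjacent vertices with the same neighbors otherwise. -/
def HasTrueTwins {W : Type*} (F : SimpleGraph W) : Prop :=
  ∃ u v, F.Adj u v ∧ ∀ w, w ≠ u → w ≠ v → (F.Adj w u ↔ F.Adj w v)

/-- Replacing a vertex by a complete graph creates no new induced subgraphs without true twins. -/
theorem IsInducedFree.replaceByClique {W : Type*} {F : SimpleGraph W} (hF : ¬ HasTrueTwins F)
    (h : IsInducedFree G F) {M : Set V} {r : V} (hr : r ∈ M) {m : ℕ} :
    IsInducedFree (replaceByClique G M r m) F := by
  rintro ⟨φ⟩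
  -- Two vertices of `F` placed in the clique would be true twins. Hence at most one is, and it can
  -- be sent to `r`.
  have hone : ∀ u v i j, φ u = .inr i → φ v = .inr j → u = v := by
    intro u v i j hu hv
    by_contra huv
    have hij : i ≠ j := by
      rintro rfl
      exact huv (φ.injective (hu.trans hv.symm))
    refine hF ⟨u, v, ?_, fun w hwu hwv => ?_⟩
    · rw [← φ.map_adj_iff, hu, hv]
      exact hij
    · rw [← φ.map_adj_iff, ← φ.map_adj_iff (v := w) (w := v), hu, hv]
      rcases hw : φ w with x | n
      · rfl
      · refine iff_of_true ?_ ?_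
        · change n ≠ i
          rintro rfl
          exact hwu (φ.injective (hw.trans hu.symm))
        · change n ≠ j
          rintro rfl
          exact hwv (φ.injective (hw.trans hv.symm))
  let g : {x // x ∉ M} ⊕ Fin m → V := Sum.elim Subtype.val fun _ => r
  refine h ⟨⟨⟨fun w => g (φ w), ?_⟩, ?_⟩⟩
  · intro u v huv
    rcases hu : φ u with x | i <;> rcases hv : φ v with y | j <;>
      simp only [hu, hv, g, Sum.elim_inl, Sum.elim_inr] at huv
    · exact φ.injective (by rw [hu, hv, Subtype.ext huv])
    · exact absurd (huv ▸ hr) x.2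
    · exact absurd (huv ▸ hr) y.2
    · exact hone u v i j hu hv
  · intro u v
    rw [← φ.map_adj_iff (v := u) (w := v)]
    change G.Adj (g (φ u)) (g (φ v)) ↔ _
    rcases hu : φ u with x | i <;> rcases hv : φ v with y | j
    · rfl
    · rfl
    · exact G.adj_comm _ _
    · have huv := hone u v i j hu hv
      subst huv
      rw [hu] at hv
      cases hv
      exact iff_of_false (G.loopless.irrefl _) (SimpleGraph.irrefl _)

end Recoloring

/-! ### Graphs without three independent vertices -/

namespace Recoloring

variable {V : Type*} {G : SimpleGraph V}

/-- Among any three distinct vertices there are two adjacent ones. -/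
def NoIndependentTriple (G : SimpleGraph V) : Prop :=
  ∀ a b c, a ≠ b → a ≠ c → b ≠ c → G.Adj a b ∨ G.Adj a c ∨ G.Adj b c

/-- Color classes are independent, so they have at most two elements. -/
theorem NoIndependentTriple.eq_of_color {l : ℕ} (h3 : NoIndependentTriple G)
    (α : G.Coloring (Fin l)) {a b c : V} (hab : α a = α b) (hac : α a = α c) (h1 : a ≠ b)
    (h2 : a ≠ c) : b = c := by
  by_contra h
  rcases h3 a b c h1 h2 h with h | h | h
  · exact α.valid h hab
  · exact α.valid h hac
  · exact α.valid h (hab.symm.trans hac)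

/-- The number of values of a function in terms of the sizes of its fibers. -/
theorem sum_inv_card_fiber [Fintype V] {ι : Type*} [DecidableEq ι] (f : V → ι) :
    ∑ v : V, (1 : ℚ) / (Finset.univ.filter fun w => f w = f v).card =
      (Finset.univ.image f).card := by
  rw [← Finset.sum_fiberwise_of_maps_to (g := f) (t := Finset.univ.image f)
    (fun v _ => Finset.mem_image_of_mem f (Finset.mem_univ v)), Finset.card_eq_sum_ones,
    Nat.cast_sum]
  refine Finset.sum_congr rfl fun c hc => ?_
  obtain ⟨v, -, rfl⟩ := Finset.mem_image.1 hc
  have hpos : (0 : ℚ) < (Finset.univ.filter fun w => f w = f v).card := by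
    exact_mod_cast Finset.card_pos.2 ⟨v, by simp⟩
  rw [Finset.sum_congr rfl (g := fun _ => (1 : ℚ) / (Finset.univ.filter fun w => f w = f v).card)
    (fun w hw => by rw [(Finset.mem_filter.1 hw).2]), Finset.sum_const, nsmul_eq_mul, Nat.cast_one]
  field_simp

theorem colorable_card_image [Fintype V] {l : ℕ} (α : G.Coloring (Fin l)) :
    G.Colorable (Finset.univ.image α).card := by
  have c : G.Coloring (Finset.univ.image α) := SimpleGraph.Coloring.mk
    (fun v => ⟨α v, Finset.mem_image_of_mem α (Finset.mem_univ v)⟩)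
    (fun h he => α.valid h (congrArg Subtype.val he))
  have h := c.colorable
  rwa [Fintype.card_coe] at h

open Classical in
/-- The number of pairs of vertices that are monochromatic for both colorings. -/
noncomputable def commonPairs [Fintype V] {k m : ℕ} (α : G.Coloring (Fin k))
    (β : G.Coloring (Fin m)) : ℕ :=
  (Finset.univ.filter fun p : V × V => α p.1 = α p.2 ∧ β p.1 = β p.2).card

theorem commonPairs_lt [Fintype V] {k m : ℕ} {α α' : G.Coloring (Fin k)} {β : G.Coloring (Fin m)}
    (h : ∀ x y, α x = α y → β x = β y → α' x = α' y) {x y : V} (hα : α x ≠ α y)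
    (hα' : α' x = α' y) (hβ : β x = β y) : commonPairs α β < commonPairs α' β := by
  classical
  refine Finset.card_lt_card ⟨fun p hp => ?_, fun hle => ?_⟩
  · rw [Finset.mem_filter] at hp ⊢
    exact ⟨hp.1, h _ _ hp.2.1 hp.2.2, hp.2.2⟩
  · have := @hle (x, y) (Finset.mem_filter.2 ⟨Finset.mem_univ _, hα', hβ⟩)
    exact hα (Finset.mem_filter.1 this).2.1

/-- A color class of size one can be enlarged to an optimal one. -/
theorem exists_commonPairs_lt_of_single [Fintype V] (h3 : NoIndependentTriple G) {k m : ℕ}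
    (α : G.Coloring (Fin k)) (β : G.Coloring (Fin m)) {u v : V} (hv : ∀ w, α w = α v → w = v)
    (huv : u ≠ v) (hβ : β u = β v) :
    ∃ α' : G.Coloring (Fin k), (reconfigurationGraph G k).Reachable α α' ∧
      commonPairs α β < commonPairs α' β := by
  have hval : ∀ w, G.Adj u w → α w ≠ α v := by
    intro w hw he
    rw [hv w he] at hw
    exact β.valid hw hβ
  have hαuv : α u ≠ α v := fun h => huv (hv u h)
  -- No common pair is lost: the only `β`-partner of `u` is `v`.
  have hnot : ∀ y, y ≠ u → α y = α u → β y = β u → False := by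
    intro y hyu hy1 hy2
    have : y = v := h3.eq_of_color β hy2.symm hβ hyu.symm huv
    rw [this] at hy1
    exact hαuv hy1.symm
  refine ⟨recolor α u (α v) hval, reachable_recolor _ _ _ _,
    commonPairs_lt (x := u) (y := v) (fun x y hxy hxy' => ?_) hαuv ?_ hβ⟩
  · by_cases hx : x = u <;> by_cases hy : y = u
    · rw [hx, hy]
    · subst hx
      exact (hnot y hy hxy.symm hxy'.symm).elim
    · subst hy
      exact (hnot x hx hxy hxy').elim
    · rw [recolor_of_ne _ _ _ _ hx, recolor_of_ne _ _ _ _ hy, hxy]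
  · rw [recolor_self, recolor_of_ne _ _ _ _ huv.symm]

/-- A free color allows one to replace a color class by an optimal one. -/
theorem exists_commonPairs_lt_of_free [Fintype V] (h3 : NoIndependentTriple G) {k m : ℕ}
    (α : G.Coloring (Fin k)) (β : G.Coloring (Fin m)) {f : Fin k} (hf : ∀ w, α w ≠ f)
    {u v w : V} (huv : α u = α v) (hβ : β u ≠ β v) (hwu : w ≠ u) (hβw : β w = β u) :
    ∃ α' : G.Coloring (Fin k), (reconfigurationGraph G k).Reachable α α' ∧
      commonPairs α β < commonPairs α' β := by
  -- The `β`-pair `u, w` is to receive the free color `f`. No common pair is lost, since the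
  -- `α`-partner `v` of `u` is not a `β`-partner, and the only `β`-partner of `w` is `u`.
  have hval : ∀ x, G.Adj w x → recolor α u f (fun x _ => hf x) x ≠ f := by
    intro x hx
    by_cases hxu : x = u
    · subst hxu
      exact absurd hβw (β.valid hx)
    · rw [recolor_of_ne _ _ _ _ hxu]
      exact hf x
  have hne : u ≠ v := fun h => hβ (congrArg β h)
  have hαw : α u ≠ α w := by
    intro h
    have : v = w := h3.eq_of_color α huv h hne hwu.symm
    rw [this] at hβ
    exact hβ hβw.symm
  have hu : ∀ y, y ≠ u → α y = α u → β y = β u → False := by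
    intro y hyu hy1 hy2
    have : y = v := h3.eq_of_color α hy1.symm huv hyu.symm hne
    rw [this] at hy2
    exact hβ hy2.symm
  have hw : ∀ y, y ≠ w → α y = α w → β y = β w → False := by
    intro y hyw hy1 hy2
    have : y = u := h3.eq_of_color β hy2.symm hβw hyw.symm hwu
    rw [this] at hy1
    exact hαw hy1
  have hself : recolor (recolor α u f fun x _ => hf x) w f hval u = f := by
    rw [recolor_of_ne _ _ _ _ hwu.symm, recolor_self]
  refine ⟨recolor (recolor α u f fun x _ => hf x) w f hval,
    (reachable_recolor _ _ _ _).trans (reachable_recolor _ _ _ _),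
    commonPairs_lt (x := u) (y := w) (fun x y hxy hxy' => ?_) hαw ?_ hβw.symm⟩
  · by_cases hx : x = y
    · rw [hx]
    have h1 : x ≠ u := by
      rintro rfl
      exact hu y (Ne.symm hx) hxy.symm hxy'.symm
    have h2 : y ≠ u := by
      rintro rfl
      exact hu x hx hxy hxy'
    have h3 : x ≠ w := by
      rintro rfl
      exact hw y (Ne.symm hx) hxy.symm hxy'.symm
    have h4 : y ≠ w := by
      rintro rfl
      exact hw x hx hxy hxy'
    rw [recolor_of_ne _ _ _ _ h3, recolor_of_ne _ _ _ _ h4, recolor_of_ne _ _ _ _ h1,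
      recolor_of_ne _ _ _ _ h2, hxy]
  · rw [hself, recolor_self]

theorem exists_commonPairs_lt [Fintype V] (h3 : NoIndependentTriple G) {k m : ℕ} (hmk : m ≤ k)
    (hmin : ∀ j, G.Colorable j → m ≤ j) (α : G.Coloring (Fin (k + 1))) (β : G.Coloring (Fin m))
    (h : ¬ ∀ u v, α u = α v ↔ β u = β v) :
    ∃ α' : G.Coloring (Fin (k + 1)), (reconfigurationGraph G (k + 1)).Reachable α α' ∧
      commonPairs α β < commonPairs α' β := by
  classical
  by_cases hs : ∃ v, (∀ w, α w = α v → w = v) ∧ ∃ u, u ≠ v ∧ β u = β v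
  · obtain ⟨v, hv, u, huv, hβ⟩ := hs
    exact exists_commonPairs_lt_of_single h3 α β hv huv hβ
  push Not at hs
  have hfib : ∀ {l : ℕ} (γ : G.Coloring (Fin l)) (v : V),
      ((Finset.univ.filter fun w => γ w = γ v).card = 1 ∧ ∀ w, γ w = γ v → w = v) ∨
      ((Finset.univ.filter fun w => γ w = γ v).card = 2 ∧ ∃ w, w ≠ v ∧ γ w = γ v) := by
    intro l γ v
    by_cases hex : ∃ w, w ≠ v ∧ γ w = γ v
    · obtain ⟨w, hw, hγ⟩ := hex
      refine Or.inr ⟨?_, w, hw, hγ⟩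
      rw [Finset.card_eq_two]
      refine ⟨v, w, hw.symm, ?_⟩
      ext x
      simp only [Finset.mem_filter, Finset.mem_univ, true_and, Finset.mem_insert,
        Finset.mem_singleton]
      refine ⟨fun hx => ?_, ?_⟩
      · by_contra hne
        push Not at hne
        exact hne.2 (h3.eq_of_color γ hx.symm hγ.symm hne.1.symm hw.symm)
      · rintro (rfl | rfl)
        · rfl
        · exact hγ
    · push Not at hex
      have hall : ∀ w, γ w = γ v → w = v := fun w hw => by_contra fun hne => hex w hne hw
      refine Or.inl ⟨?_, hall⟩
      rw [Finset.card_eq_one]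
      refine ⟨v, ?_⟩
      ext x
      simp only [Finset.mem_filter, Finset.mem_univ, true_and, Finset.mem_singleton]
      exact ⟨hall x, fun h => by rw [h]⟩
  -- A vertex alone in its `α`-class is now also alone in its `β`-class. Summing inverse class
  -- sizes, `α` has at most as many colors as `β`; since `m` is minimal, equality holds, also term
  -- by term, so the same vertices lie in classes of size two.
  have hle : ∀ v ∈ (Finset.univ : Finset V),
      (1 : ℚ) / (Finset.univ.filter fun w => α w = α v).card ≤
        1 / (Finset.univ.filter fun w => β w = β v).card := by
    intro v _
    rcases hfib α v with ⟨h1, h1'⟩ | ⟨h1, -⟩ <;> rcases hfib β v with ⟨h2, -⟩ | ⟨h2, w, hw, hw'⟩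
    · rw [h1, h2]
    · exact absurd hw' (hs v h1' w hw)
    · rw [h1, h2]; norm_num
    · rw [h1, h2]
  have hsum := Finset.sum_le_sum hle
  have hβm : (Finset.univ.image β).card ≤ m := by
    simpa using Finset.card_le_univ (Finset.univ.image β)
  have hαm := hmin _ (colorable_card_image α)
  have hαβ : (Finset.univ.image α).card ≤ (Finset.univ.image β).card := by
    rw [sum_inv_card_fiber, sum_inv_card_fiber] at hsum
    exact_mod_cast hsum
  have heq := (Finset.sum_eq_sum_iff_of_le hle).1 (by
    rw [sum_inv_card_fiber, sum_inv_card_fiber]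
    exact_mod_cast le_antisymm hαβ (hβm.trans hαm))
  have hiff : ∀ v, (∃ w, w ≠ v ∧ α w = α v) ↔ ∃ w, w ≠ v ∧ β w = β v := by
    intro v
    have hv := heq v (Finset.mem_univ v)
    rcases hfib α v with ⟨h1, h1'⟩ | ⟨h1, h1'⟩ <;> rcases hfib β v with ⟨h2, h2'⟩ | ⟨h2, h2'⟩
    · exact iff_of_false (fun ⟨w, hw, hw'⟩ => hw (h1' w hw')) fun ⟨w, hw, hw'⟩ => hw (h2' w hw')
    · rw [h1, h2] at hv; norm_num at hv
    · rw [h1, h2] at hv; norm_num at hv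
    · exact iff_of_true h1' h2'
  -- `α` uses at most `m ≤ k` of the `k + 1` colors.
  obtain ⟨f, hf⟩ : ∃ f, f ∉ Finset.univ.image α := by
    by_contra hall
    push Not at hall
    have := Finset.card_le_card (fun c _ => hall c : Finset.univ ⊆ Finset.univ.image α)
    rw [Finset.card_univ, Fintype.card_fin] at this
    omega
  have hf' : ∀ w, α w ≠ f := fun w hw => hf (Finset.mem_image.2 ⟨w, Finset.mem_univ w, hw⟩)
  push Not at h
  obtain ⟨u, v, ⟨h1, h2⟩ | ⟨h1, h2⟩⟩ := h
  · obtain ⟨w, hw, hw'⟩ := (hiff u).1 ⟨v, fun h => h2 (by rw [h]), h1.symm⟩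
    exact exists_commonPairs_lt_of_free h3 α β hf' h1 h2 hw hw'
  · have huv : u ≠ v := fun h => h1 (by rw [h])
    obtain ⟨w, hw, hw'⟩ := (hiff u).2 ⟨v, huv.symm, h2.symm⟩
    refine exists_commonPairs_lt_of_free h3 α β hf' hw'.symm (fun he => ?_) huv.symm h2.symm
    have : w = v := h3.eq_of_color β he h2 hw.symm huv
    rw [this] at hw'
    exact h1 hw'.symm

/-- Graphs whose complement is triangle-free. -/
theorem NoIndependentTriple.mixesAboveChromatic [Finite V] (h3 : NoIndependentTriple G) :
    MixesAboveChromatic G := by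
  classical
  have := Fintype.ofFinite V
  intro k hk
  have hex : ∃ m, G.Colorable m := ⟨k, hk⟩
  let m := Nat.find hex
  have hmin : ∀ j, G.Colorable j → m ≤ j := fun j hj => Nat.find_min' hex hj
  have hmk : m ≤ k := hmin k hk
  obtain ⟨β⟩ : G.Colorable m := Nat.find_spec hex
  have hsurj : Function.Surjective β := by
    have h1 : (Finset.univ.image β) = Finset.univ := by
      rw [← Finset.card_eq_iff_eq_univ, Fintype.card_fin]
      refine le_antisymm ?_ (hmin _ (colorable_card_image β))
      simpa using Finset.card_le_univ (Finset.univ.image β)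
    intro c
    have := Finset.mem_univ c
    rw [← h1] at this
    obtain ⟨v, -, hv⟩ := Finset.mem_image.1 this
    exact ⟨v, hv⟩
  have align : ∀ n (α : G.Coloring (Fin (k + 1))),
      Fintype.card (V × V) - commonPairs α β = n → ∃ α' : G.Coloring (Fin (k + 1)),
        (reconfigurationGraph G (k + 1)).Reachable α α' ∧ ∀ u v, α' u = α' v ↔ β u = β v := by
    intro n
    induction n using Nat.strong_induction_on with
    | _ n ih =>
      intro α hn
      by_cases h : ∀ u v, α u = α v ↔ β u = β v
      · exact ⟨α, SimpleGraph.Reachable.refl _, h⟩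
      · obtain ⟨α', h1, h2⟩ := exists_commonPairs_lt h3 hmk hmin α β h
        have h3 : commonPairs α' β ≤ Fintype.card (V × V) := Finset.card_le_univ _
        obtain ⟨α'', h4, h5⟩ := ih _ (by omega) α' rfl
        exact ⟨α'', h1.trans h4, h5⟩
  let δ₀ : (⊤ : SimpleGraph (Fin m)).Coloring (Fin (k + 1)) :=
    SimpleGraph.Coloring.mk (Fin.castLE (by omega))
      (fun h he => h (Fin.castLE_injective _ he))
  have hK : MixesAboveChromatic (⊤ : SimpleGraph (Fin m)) :=
    mixesAboveChromatic_of_complete _ rfl fun _ _ h => h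
  have hKk : (⊤ : SimpleGraph (Fin m)).Colorable k :=
    ⟨SimpleGraph.Coloring.mk (Fin.castLE hmk) fun h he => h (Fin.castLE_injective _ he)⟩
  -- Once its classes are those of `β`, a coloring factors through `β`, seen as a homomorphism to
  -- the complete graph on `m` vertices.
  have main : ∀ α : G.Coloring (Fin (k + 1)),
      (reconfigurationGraph G (k + 1)).Reachable α (pullback δ₀ β) := by
    intro α
    obtain ⟨α', h1, h2⟩ := align _ α rfl
    let δ : (⊤ : SimpleGraph (Fin m)).Coloring (Fin (k + 1)) :=
      SimpleGraph.Coloring.mk (fun i => α' (Function.surjInv hsurj i)) (by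
        intro i j hij he
        rw [h2, Function.surjInv_eq hsurj, Function.surjInv_eq hsurj] at he
        exact hij he)
    have hδ : α' = pullback δ β := by
      refine DFunLike.ext _ _ fun x => ?_
      rw [pullback_apply]
      exact (h2 _ _).2 (Function.surjInv_eq hsurj _).symm
    rw [hδ] at h1
    exact h1.trans (reachable_pullback (hK k hKk δ δ₀) β)
  exact fun α β' => (main α).trans (main β').symm

end Recoloring

/-! ### Forbidden subgraphs as adjacency conditions; no induced `C₄` or `C₅` -/

namespace Recoloring

variable {V : Type*} {G : SimpleGraph V}

/-- No five vertices induce a path. -/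
def NoPath5 (G : SimpleGraph V) : Prop := ∀ a b c d e, G.Adj a b → G.Adj b c → G.Adj c d →
  G.Adj d e → ¬ G.Adj a c → ¬ G.Adj a d → ¬ G.Adj a e → ¬ G.Adj b d → ¬ G.Adj b e →
  ¬ G.Adj c e → False

/-- No five vertices `a, b, c, d, e` induce a house with cycle `a, b, c, d` and top `e`. -/
def NoHouse (G : SimpleGraph V) : Prop := ∀ a b c d e, G.Adj a b → G.Adj b c → G.Adj c d →
  G.Adj d a → G.Adj e b → G.Adj e c → ¬ G.Adj a c → ¬ G.Adj b d → ¬ G.Adj e a → ¬ G.Adj e d →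
  False

/-- No five vertices induce a bull consisting of a path `a, b, c, d` and a vertex `e` adjacent to
`b` and `c`. -/
def NoBull (G : SimpleGraph V) : Prop := ∀ a b c d e, G.Adj a b → G.Adj b c → G.Adj c d →
  G.Adj e b → G.Adj e c → ¬ G.Adj a c → ¬ G.Adj a d → ¬ G.Adj b d → ¬ G.Adj e a → ¬ G.Adj e d →
  False

/-- No five vertices induce a cycle. -/
def NoCycle5 (G : SimpleGraph V) : Prop := ∀ a b c d e, G.Adj a b → G.Adj b c → G.Adj c d →
  G.Adj d e → G.Adj e a → ¬ G.Adj a c → ¬ G.Adj b d → ¬ G.Adj c e → ¬ G.Adj d a → ¬ G.Adj e b →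
  False

/-- A map that preserves and reflects adjacency is an embedding if the domain has no two vertices
with the same neighbors. -/
theorem IsInducedFree.false_of_map {W : Type*} {F : SimpleGraph W} (h : IsInducedFree G F)
    (hF : ∀ i j, (∀ k, F.Adj i k ↔ F.Adj j k) → i = j) (f : W → V)
    (hf : ∀ i j, G.Adj (f i) (f j) ↔ F.Adj i j) : False :=
  h ⟨⟨⟨f, fun i j hij => hF i j fun k => by rw [← hf, ← hf, hij]⟩, hf _ _⟩⟩

theorem noPath5_of_isInducedFree (h : IsInducedFree G (SimpleGraph.pathGraph 5)) : NoPath5 G := by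
  intro a b c d e h1 h2 h3 h4 n1 n2 n3 n4 n5 n6
  refine h.false_of_map ?_ ![a, b, c, d, e] ?_
  · simp only [SimpleGraph.pathGraph_adj]
    decide
  · intro i j
    rw [SimpleGraph.pathGraph_adj]
    fin_cases i <;> fin_cases j <;> simp [*, G.adj_comm]

theorem house_adj (i j : Fin 5) : house.Adj i j ↔
    (i, j) ∈ ([(0, 1), (1, 0), (1, 2), (2, 1), (2, 3), (3, 2), (3, 0), (0, 3), (4, 1), (1, 4),
      (4, 2), (2, 4)] : List (Fin 5 × Fin 5)) := by
  rw [house, SimpleGraph.fromEdgeSet_adj]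
  revert i j
  simp only [Set.mem_insert_iff, Set.mem_singleton_iff]
  decide

theorem bull_adj (i j : Fin 5) : bull.Adj i j ↔
    (i, j) ∈ ([(0, 3), (3, 0), (3, 4), (4, 3), (4, 0), (0, 4), (0, 1), (1, 0), (3, 2),
      (2, 3)] : List (Fin 5 × Fin 5)) := by
  rw [bull, SimpleGraph.fromEdgeSet_adj]
  revert i j
  simp only [Set.mem_insert_iff, Set.mem_singleton_iff]
  decide

theorem noHouse_of_isInducedFree (h : IsInducedFree G house) : NoHouse G := by
  intro a b c d e h1 h2 h3 h4 h5 h6 n1 n2 n3 n4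
  refine h.false_of_map ?_ ![a, b, c, d, e] ?_
  · simp only [house_adj]
    decide
  · intro i j
    rw [house_adj]
    have sy : ∀ {x y}, G.Adj x y → G.Adj y x := fun h => h.symm
    fin_cases i <;> fin_cases j <;> simp [h1, h2, h3, h4, h5, h6, n1, n2, n3, n4,
      h1.symm, h2.symm, h3.symm, h4.symm, h5.symm, h6.symm, mt sy n1, mt sy n2, mt sy n3, mt sy n4]

theorem noBull_of_isInducedFree (h : IsInducedFree G bull) : NoBull G := by
  intro a b c d e h1 h2 h3 h4 h5 n1 n2 n3 n4 n5
  -- In `bull` the path is `1, 0, 3, 2`, and `4` is the vertex adjacent to `0` and `3`.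
  refine h.false_of_map ?_ ![b, a, d, c, e] ?_
  · simp only [bull_adj]
    decide
  · intro i j
    rw [bull_adj]
    have sy : ∀ {x y}, G.Adj x y → G.Adj y x := fun h => h.symm
    fin_cases i <;> fin_cases j <;> simp [h1, h2, h3, h4, h5, n1, n2, n3, n4, n5, h1.symm, h2.symm,
      h3.symm, h4.symm, h5.symm, mt sy n1, mt sy n2, mt sy n3, mt sy n4, mt sy n5]

theorem not_hasTrueTwins_pathGraph : ¬ HasTrueTwins (SimpleGraph.pathGraph 5) := by
  simp only [HasTrueTwins, SimpleGraph.pathGraph_adj]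
  decide

theorem not_hasTrueTwins_house : ¬ HasTrueTwins house := by
  let : DecidableRel house.Adj := fun i j => decidable_of_iff _ (house_adj i j).symm
  unfold HasTrueTwins
  decide

theorem not_hasTrueTwins_bull : ¬ HasTrueTwins bull := by
  let : DecidableRel bull.Adj := fun i j => decidable_of_iff _ (bull_adj i j).symm
  unfold HasTrueTwins
  decide

/-- Every module other than the whole vertex set is a clique. -/
def ModulesAreCliques (G : SimpleGraph V) : Prop :=
  ∀ M : Set V, IsModule G M → (∃ v, v ∉ M) → ∀ x ∈ M, ∀ y ∈ M, x ≠ y → G.Adj x y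

/-- In a graph without induced cycles of length four or five and without induced paths on five
vertices, every vertex of minimum degree is simplicial. -/
theorem exists_simplicial_of_no_cycle4 [Finite V] [Nonempty V] (hP : NoPath5 G)
    (hC5 : NoCycle5 G) (hC4 : ∀ a b c d, G.Adj a b → G.Adj b c → G.Adj c d → G.Adj d a →
      G.Adj a c ∨ G.Adj b d ∨ a = c ∨ b = d) : ∃ u, IsSimplicial G u := by
  obtain ⟨b, hb⟩ := Finite.exists_min fun v => (G.neighborSet v).ncard
  refine ⟨b, fun x y hx hy hxy => ?_⟩
  by_contra hadj
  -- Otherwise `x` would have smaller degree than `b`.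
  have outside : ∀ x y, G.Adj b x → G.Adj b y → x ≠ y → ¬ G.Adj x y →
      ∃ c, G.Adj x c ∧ c ≠ b ∧ ¬ G.Adj b c := by
    intro x y hx hy hxy hadj
    by_contra hall
    push Not at hall
    -- the neighbors of `x` other than `b` are neighbors of `b` other than `x` and `y`
    have hlt : G.neighborSet x \ {b} ⊆ (G.neighborSet b \ {y}) \ {x} := by
      rintro c ⟨hc, hcb⟩
      refine ⟨⟨hall c hc hcb, ?_⟩, ?_⟩
      · rintro rfl
        exact hadj hc
      · rintro rfl
        exact G.loopless.irrefl _ hc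
    have h1 := Set.ncard_le_ncard hlt
    have hbx : b ∈ G.neighborSet x := hx.symm
    have hyb : y ∈ G.neighborSet b := hy
    have hxb : x ∈ G.neighborSet b \ {y} := ⟨hx, hxy⟩
    have h2 := Set.ncard_sdiff_singleton_add_one hbx
    have h3 := Set.ncard_sdiff_singleton_add_one hyb
    have h4 := Set.ncard_sdiff_singleton_add_one hxb
    have h5 := hb x
    omega
  obtain ⟨c, hxc, hcb, hbc⟩ := outside x y hx hy hxy hadj
  obtain ⟨d, hyd, hdb, hbd⟩ := outside y x hy hx hxy.symm fun h => hadj h.symm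
  have hyc : ¬ G.Adj y c := by
    intro h
    rcases hC4 x c y b hxc h.symm hy.symm hx with h | h | h | h
    · exact hadj h
    · exact hbc h.symm
    · exact hxy h
    · exact hcb h
  have hxd : ¬ G.Adj x d := by
    intro h
    rcases hC4 x d y b h hyd.symm hy.symm hx with h | h | h | h
    · exact hadj h
    · exact hbd h.symm
    · exact hxy h
    · exact hdb h
  -- `c, x, b, y, d` is an induced cycle or an induced path.
  by_cases hcd : G.Adj c d
  · exact hC5 c x b y d hxc.symm hx.symm hy hyd hcd.symm (fun h => hbc h.symm) hadj hbd hyc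
      fun h => hxd h.symm
  · exact hP c x b y d hxc.symm hx.symm hy hyd (fun h => hbc h.symm) (fun h => hyc h.symm) hcd
      hadj hxd hbd

end Recoloring

/-! ### Induced cycles of length five -/

namespace Recoloring

variable {V : Type*} {G : SimpleGraph V}

/-- The vertices `c 0, …, c 4` induce a cycle, in this order. -/
def IsInducedCycle5 (G : SimpleGraph V) (c : Fin 5 → V) : Prop :=
  ∀ i, G.Adj (c i) (c (i + 1)) ∧ ¬ G.Adj (c i) (c (i + 2))

/-- The vertex `v` has the same neighbors as `c i` on the other vertices of the cycle `c`. -/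
def IsCycleTwin (G : SimpleGraph V) (c : Fin 5 → V) (i : Fin 5) (v : V) : Prop :=
  G.Adj v (c (i + 1)) ∧ G.Adj v (c (i + 4)) ∧ ¬ G.Adj v (c (i + 2)) ∧ ¬ G.Adj v (c (i + 3))

theorem IsInducedCycle5.adj_iff {c : Fin 5 → V} (hc : IsInducedCycle5 G c) (i j : Fin 5) :
    G.Adj (c i) (c j) ↔ j = i + 1 ∨ i = j + 1 := by
  have hcases : ∀ i j : Fin 5, i = j ∨ j = i + 1 ∨ i = j + 1 ∨ j = i + 2 ∨ i = j + 2 := by decide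
  have h1 : ∀ i : Fin 5, ¬ (i = i + 1 ∨ i = i + 1) := by decide
  have h2 : ∀ i : Fin 5, ¬ (i + 2 = i + 1 ∨ i = i + 2 + 1) := by decide
  rcases hcases i j with rfl | rfl | rfl | rfl | rfl
  · exact iff_of_false (G.loopless.irrefl _) (h1 _)
  · exact iff_of_true (hc i).1 (Or.inl rfl)
  · exact iff_of_true (hc j).1.symm (Or.inr rfl)
  · exact iff_of_false (hc i).2 (h2 _)
  · exact iff_of_false (fun h => (hc j).2 h.symm) fun h => h2 _ h.symm

theorem IsInducedCycle5.isCycleTwin_self {c : Fin 5 → V} (hc : IsInducedCycle5 G c) (i : Fin 5) :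
    IsCycleTwin G c i (c i) := by
  simp only [IsCycleTwin, hc.adj_iff]
  decide +revert

/-- Whether `v` is adjacent to `c i` is irrelevant, as `c i` leaves the cycle. Facts about a vertex
and a cycle thereby become facts about a vertex and a twin. -/
theorem IsInducedCycle5.update {c : Fin 5 → V} (hc : IsInducedCycle5 G c) {i : Fin 5} {v : V}
    (hv : IsCycleTwin G c i v) : IsInducedCycle5 G (Function.update c i v) := by
  have hcases : ∀ i j : Fin 5, j = i ∨ j = i + 1 ∨ j = i + 2 ∨ j = i + 3 ∨ j = i + 4 := by decide
  have e : ∀ i : Fin 5, i + 1 ≠ i ∧ i + 2 ≠ i ∧ i + 3 ≠ i ∧ i + 4 ≠ i ∧ i + 1 + 1 = i + 2 ∧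
    i + 1 + 2 = i + 3 ∧ i + 2 + 1 = i + 3 ∧ i + 2 + 2 = i + 4 ∧ i + 3 + 1 = i + 4 ∧
    i + 3 + 2 = i ∧ i + 4 + 1 = i ∧ i + 4 + 2 = i + 1 := by decide
  obtain ⟨e1, e2, e3, e4, e5, e6, e7, e8, e9, e10, e11, e12⟩ := e i
  obtain ⟨h1, h2, h3, h4⟩ := hv
  intro j
  have hj := hc j
  rcases hcases i j with rfl | rfl | rfl | rfl | rfl
  · rw [Function.update_self, Function.update_of_ne e1, Function.update_of_ne e2]
    exact ⟨h1, h3⟩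
  · rw [e5, e6] at hj ⊢
    rwa [Function.update_of_ne e1, Function.update_of_ne e2, Function.update_of_ne e3]
  · rw [e7, e8] at hj ⊢
    rwa [Function.update_of_ne e2, Function.update_of_ne e3, Function.update_of_ne e4]
  · rw [e9, e10] at hj ⊢
    rw [Function.update_self, Function.update_of_ne e3, Function.update_of_ne e4]
    exact ⟨hj.1, fun h => h4 h.symm⟩
  · rw [e11, e12] at hj ⊢
    rw [Function.update_self, Function.update_of_ne e4, Function.update_of_ne e1]
    exact ⟨h2.symm, hj.2⟩

section
variable {c : Fin 5 → V}

theorem IsInducedCycle5.false_of_path (hc : IsInducedCycle5 G c) (hP : NoPath5 G) {v : V}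
    (i : Fin 5) (h0 : G.Adj v (c i)) (h1 : ¬ G.Adj v (c (i + 1))) (h2 : ¬ G.Adj v (c (i + 2)))
    (h3 : ¬ G.Adj v (c (i + 3))) : False := by
  refine hP v (c i) (c (i + 1)) (c (i + 2)) (c (i + 3)) h0 ?_ ?_ ?_ h1 h2 h3 ?_ ?_ ?_ <;>
    rw [hc.adj_iff] <;> clear h0 h1 h2 h3 <;> decide +revert

theorem IsInducedCycle5.false_of_house (hc : IsInducedCycle5 G c) (hH : NoHouse G) {v : V}
    (i : Fin 5) (h0 : G.Adj v (c i)) (h1 : G.Adj v (c (i + 1))) (h2 : ¬ G.Adj v (c (i + 2)))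
    (h3 : G.Adj v (c (i + 3))) : False := by
  refine hH (c (i + 3)) v (c (i + 1)) (c (i + 2)) (c i) h3.symm h1 ?_ ?_ h0.symm ?_ ?_ h2 ?_ ?_ <;>
    rw [hc.adj_iff] <;> clear h0 h1 h2 h3 <;> decide +revert

/-- Of the 32 possible neighborhoods of `v` on the cycle, only these avoid every rotation of the
path and the house above. -/
theorem IsInducedCycle5.classify (hc : IsInducedCycle5 G c) (hP : NoPath5 G) (hH : NoHouse G)
    (v : V) : (∀ i, G.Adj v (c i)) ∨ (∀ i, ¬ G.Adj v (c i)) ∨ ∃ i, IsCycleTwin G c i v := by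
  have key : ∀ p : Fin 5 → Bool,
      (∀ i, (p i && !p (i + 1) && !p (i + 2) && !p (i + 3)) = false) →
      (∀ i, (p i && p (i + 1) && !p (i + 2) && p (i + 3)) = false) →
      (∀ i, p i = true) ∨ (∀ i, p i = false) ∨
        ∃ i, (p (i + 1) && p (i + 4) && !p (i + 2) && !p (i + 3)) = true := by decide
  classical
  have h1 : ∀ i, (decide (G.Adj v (c i)) && !decide (G.Adj v (c (i + 1))) &&
      !decide (G.Adj v (c (i + 2))) && !decide (G.Adj v (c (i + 3)))) = false := by
    intro i
    have := hc.false_of_path hP (v := v) i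
    simpa using this
  have h2 : ∀ i, (decide (G.Adj v (c i)) && decide (G.Adj v (c (i + 1))) &&
      !decide (G.Adj v (c (i + 2))) && decide (G.Adj v (c (i + 3)))) = false := by
    intro i
    have := hc.false_of_house hH (v := v) i
    simp only [Bool.and_eq_false_iff, decide_eq_false_iff_not, Bool.not_eq_false',
      decide_eq_true_eq]
    tauto
  rcases key (fun i => decide (G.Adj v (c i))) h1 h2 with h | h | ⟨i, h⟩
  · exact Or.inl fun i => of_decide_eq_true (h i)
  · exact Or.inr (Or.inl fun i => of_decide_eq_false (h i))
  · refine Or.inr (Or.inr ⟨i, ?_⟩)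
    simpa [IsCycleTwin, and_assoc] using h

/-- Otherwise `w, c (i + 2), c (i + 3), c (i + 4), v` is an induced path. -/
theorem IsInducedCycle5.adj_of_twins (hc : IsInducedCycle5 G c) (hP : NoPath5 G) {i : Fin 5}
    {v w : V} (hv : IsCycleTwin G c i v) (hw : IsCycleTwin G c (i + 1) w) : G.Adj v w := by
  by_contra h
  have e : ∀ i : Fin 5, i + 1 ≠ i ∧ i + 2 ≠ i ∧ i + 3 ≠ i ∧ i + 4 ≠ i ∧ i + 1 + 1 = i + 2 ∧
    i + 1 + 2 = i + 3 ∧ i + 1 + 3 = i + 4 ∧ i + 2 + 1 = i + 3 ∧ i + 2 + 2 = i + 4 ∧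
    i + 2 + 3 = i := by decide
  obtain ⟨e1, e2, e3, e4, e5, e6, e7, e8, e9, e10⟩ := e i
  obtain ⟨h1, -, h3, h4⟩ := hw
  rw [e5] at h1
  rw [e6] at h3
  rw [e7] at h4
  refine (hc.update hv).false_of_path hP (v := w) (i + 2) ?_ ?_ ?_ ?_
  · rwa [Function.update_of_ne e2]
  · rwa [e8, Function.update_of_ne e3]
  · rwa [e9, Function.update_of_ne e4]
  · rw [e10, Function.update_self]
    exact fun hwv => h hwv.symm

/-- Put `v` in place of `c i`. If `w` is adjacent to `v`, a house arises whether or not `w` is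
adjacent to `c (i + 2)`. -/
theorem IsInducedCycle5.not_adj_of_twins (hc : IsInducedCycle5 G c) (hH : NoHouse G) {i : Fin 5}
    {v w : V} (hv : IsCycleTwin G c i v) (hw : IsCycleTwin G c (i + 2) w) : ¬ G.Adj v w := by
  intro h
  have e : ∀ i : Fin 5, i + 1 ≠ i ∧ i + 2 ≠ i ∧ i + 3 ≠ i ∧ i + 4 ≠ i ∧ i + 2 + 1 = i + 3 ∧
    i + 2 + 2 = i + 4 ∧ i + 2 + 3 = i ∧ i + 2 + 4 = i + 1 := by decide
  obtain ⟨e1, e2, e3, e4, e5, e6, e7, e8⟩ := e i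
  obtain ⟨h1, h2, h3, -⟩ := hw
  rw [e5] at h1
  rw [e8] at h2
  rw [e6] at h3
  have hself : G.Adj w (Function.update c i v i) := by
    rw [Function.update_self]
    exact h.symm
  by_cases h5 : G.Adj w (c (i + 2))
  · refine (hc.update hv).false_of_house hH (v := w) (i + 2) ?_ ?_ ?_ ?_
    · rwa [Function.update_of_ne e2]
    · rwa [e5, Function.update_of_ne e3]
    · rwa [e6, Function.update_of_ne e4]
    · rwa [e7]
  · refine (hc.update hv).false_of_house hH (v := w) i hself ?_ ?_ ?_
    · rwa [Function.update_of_ne e1]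
    · rwa [Function.update_of_ne e2]
    · rwa [Function.update_of_ne e3]

/-- A graph with an induced cycle of length five, in which every proper module is a clique, is
obtained from that cycle by replacing its vertices with complete graphs. -/
theorem IsInducedCycle5.noIndependentTriple (hc : IsInducedCycle5 G c) (hP : NoPath5 G)
    (hH : NoHouse G) (hmod : ModulesAreCliques G) : NoIndependentTriple G := by
  have hne : c 0 ≠ c 2 := by
    intro h
    have h1 := (hc 2).1
    have h2 := (hc 3).2
    rw [← h] at h1
    exact h2 h1.symm
  -- Otherwise the twins form a proper module containing the nonadjacent `c 0` and `c 2`: a vertex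
  -- complete or anticomplete to the cycle stays so for every twin.
  have hcover : ∀ v, ∃ i, IsCycleTwin G c i v := by
    by_contra hall
    push Not at hall
    obtain ⟨u, hu⟩ := hall
    refine (hc 0).2 (hmod {v | ∃ i, IsCycleTwin G c i v} ?_ ⟨u, fun ⟨i, hi⟩ => hu i hi⟩ (c 0)
      ⟨0, hc.isCycleTwin_self 0⟩ (c 2) ⟨2, hc.isCycleTwin_self 2⟩ hne)
    rintro x hx a ⟨i, ha⟩ b ⟨j, hb⟩ hxa
    have e : ∀ i : Fin 5, i + 1 ≠ i ∧ i + 2 ≠ i ∧ i + 3 ≠ i ∧ i + 4 ≠ i ∧ i + 3 + 1 = i + 4 ∧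
      i + 3 + 2 = i ∧ i + 3 + 3 = i + 1 := by decide
    rcases hc.classify hP hH x with h | h | h
    · by_contra hxb
      obtain ⟨e1, e2, e3, e4, e5, e6, e7⟩ := e j
      refine (hc.update hb).false_of_house hH (v := x) (j + 3) ?_ ?_ ?_ ?_
      · rw [Function.update_of_ne e3]
        exact h _
      · rw [e5, Function.update_of_ne e4]
        exact h _
      · rwa [e6, Function.update_self]
      · rw [e7, Function.update_of_ne e1]
        exact h _
    · obtain ⟨e1, e2, e3, -⟩ := e i
      refine ((hc.update ha).false_of_path hP (v := x) i ?_ ?_ ?_ ?_).elim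
      · rwa [Function.update_self]
      · rw [Function.update_of_ne e1]
        exact h _
      · rw [Function.update_of_ne e2]
        exact h _
      · rw [Function.update_of_ne e3]
        exact h _
    · exact absurd h hx
  have hcases : ∀ i j : Fin 5, i = j ∨ j = i + 1 ∨ i = j + 1 ∨ j = i + 2 ∨ i = j + 2 := by decide
  -- Adjacency between twins at different positions depends on the positions only, so the twins at
  -- one position form a proper module.
  have hclique : ∀ i v w, IsCycleTwin G c i v → IsCycleTwin G c i w → v ≠ w → G.Adj v w := by
    intro i v w hv hw hvw
    refine hmod {v | IsCycleTwin G c i v} ?_ ⟨c (i + 1), ?_⟩ v hv w hw hvw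
    · intro x hx a ha b hb hxa
      obtain ⟨j, hj⟩ := hcover x
      rcases hcases i j with rfl | rfl | rfl | rfl | rfl
      · exact absurd hj hx
      · exact (hc.adj_of_twins hP hb hj).symm
      · exact hc.adj_of_twins hP hj hb
      · exact absurd hxa.symm (hc.not_adj_of_twins hH ha hj)
      · exact absurd hxa (hc.not_adj_of_twins hH hj ha)
    · exact fun h => G.loopless.irrefl _ h.1
  have hnear : ∀ i j v w, IsCycleTwin G c i v → IsCycleTwin G c j w → v ≠ w →
      (i = j ∨ j = i + 1 ∨ i = j + 1) → G.Adj v w := by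
    rintro i j v w hv hw hvw (rfl | rfl | rfl)
    · exact hclique i v w hv hw hvw
    · exact hc.adj_of_twins hP hv hw
    · exact (hc.adj_of_twins hP hw hv).symm
  have hthree : ∀ i j k : Fin 5, (i = j ∨ j = i + 1 ∨ i = j + 1) ∨
      (i = k ∨ k = i + 1 ∨ i = k + 1) ∨ (j = k ∨ k = j + 1 ∨ j = k + 1) := by decide
  intro x y z hxy hxz hyz
  obtain ⟨i, hi⟩ := hcover x
  obtain ⟨j, hj⟩ := hcover y
  obtain ⟨k, hk⟩ := hcover z
  rcases hthree i j k with h | h | h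
  · exact Or.inl (hnear i j x y hi hj hxy h)
  · exact Or.inr (Or.inl (hnear i k x z hi hk hxz h))
  · exact Or.inr (Or.inr (hnear j k y z hj hk hyz h))

end

end Recoloring

/-! ### Join pairs and induced cycles of length four -/

namespace Recoloring

variable {V : Type*} {G : SimpleGraph V}

/-- A set of vertices is anticonnected if it is connected in the complement of `G`: every
partition into two nonempty parts is crossed by a nonadjacent pair. -/
def IsAnticonnected (G : SimpleGraph V) (T : Finset V) : Prop :=
  ∀ Q : V → Prop, (∃ t ∈ T, Q t) → (∃ t ∈ T, ¬ Q t) →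
    ∃ t ∈ T, ∃ s ∈ T, Q t ∧ ¬ Q s ∧ ¬ G.Adj t s

/-- Two anticonnected sets with at least two elements each that are complete to each other. -/
structure IsJoinPair (G : SimpleGraph V) (T P : Finset V) : Prop where
  anticonnected_left : IsAnticonnected G T
  anticonnected_right : IsAnticonnected G P
  nontrivial_left : T.Nontrivial
  nontrivial_right : P.Nontrivial
  adj : ∀ t ∈ T, ∀ p ∈ P, G.Adj t p

theorem IsJoinPair.symm {T P : Finset V} (h : IsJoinPair G T P) : IsJoinPair G P T :=
  ⟨h.2, h.1, h.4, h.3, fun p hp t ht => (h.5 t ht p hp).symm⟩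

theorem IsJoinPair.disjoint {T P : Finset V} (h : IsJoinPair G T P) {v : V} (hT : v ∈ T)
    (hP : v ∈ P) : False :=
  G.loopless.irrefl _ (h.adj v hT v hP)

theorem nontrivial_pair [DecidableEq V] {a b : V} (h : a ≠ b) : ({a, b} : Finset V).Nontrivial := by
  rw [Finset.Nontrivial, Finset.coe_pair]
  exact Set.nontrivial_pair h

theorem isAnticonnected_pair [DecidableEq V] {a b : V} (h : ¬ G.Adj a b) :
    IsAnticonnected G {a, b} := by
  rintro Q ⟨t, ht, hQt⟩ ⟨s, hs, hQs⟩
  refine ⟨t, ht, s, hs, hQt, hQs, ?_⟩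
  simp only [Finset.mem_insert, Finset.mem_singleton] at ht hs
  rcases ht with rfl | rfl <;> rcases hs with rfl | rfl
  · exact absurd hQt hQs
  · exact h
  · exact fun h' => h h'.symm
  · exact absurd hQt hQs

theorem IsAnticonnected.insert [DecidableEq V] {T : Finset V} (hT : IsAnticonnected G T) {v t : V}
    (ht : t ∈ T) (hvt : ¬ G.Adj v t) : IsAnticonnected G (insert v T) := by
  rintro Q ⟨a, ha, hQa⟩ ⟨b, hb, hQb⟩
  by_cases h1 : ∃ t ∈ T, Q t
  · by_cases h2 : ∃ t ∈ T, ¬ Q t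
    · obtain ⟨x, hx, y, hy, h⟩ := hT Q h1 h2
      exact ⟨x, Finset.mem_insert_of_mem hx, y, Finset.mem_insert_of_mem hy, h⟩
    · push Not at h2
      have hbv : b = v := (Finset.mem_insert.1 hb).resolve_right fun h => hQb (h2 b h)
      subst hbv
      exact ⟨t, Finset.mem_insert_of_mem ht, b, hb, h2 t ht, hQb, fun h => hvt h.symm⟩
  · push Not at h1
    have hav : a = v := (Finset.mem_insert.1 ha).resolve_right fun h => h1 a h hQa
    subst hav
    exact ⟨a, ha, t, Finset.mem_insert_of_mem ht, hQa, h1 t ht, hvt⟩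

theorem IsAnticonnected.exists_not_adj {T : Finset V} (hT : IsAnticonnected G T)
    (hnt : T.Nontrivial) {t : V} (ht : t ∈ T) : ∃ s ∈ T, s ≠ t ∧ ¬ G.Adj t s := by
  obtain ⟨a, ha, hat⟩ := hnt.exists_ne t
  obtain ⟨x, -, s, hs, rfl, h1, h2⟩ := hT (fun x => x = t) ⟨t, ht, rfl⟩ ⟨a, ha, hat⟩
  exact ⟨s, hs, h1, h2⟩

/-- A vertex outside of `T` that has both neighbors and nonneighbors in `T`. -/
def IsMixedOn (G : SimpleGraph V) (T : Finset V) (v : V) : Prop :=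
  v ∉ T ∧ (∃ t ∈ T, G.Adj v t) ∧ ∃ t ∈ T, ¬ G.Adj v t

theorem IsMixedOn.exists_pair {T : Finset V} {v : V} (hv : IsMixedOn G T v)
    (hT : IsAnticonnected G T) :
    ∃ t ∈ T, ∃ s ∈ T, G.Adj v t ∧ ¬ G.Adj v s ∧ ¬ G.Adj t s :=
  hT (fun t => G.Adj v t) hv.2.1 hv.2.2

theorem IsJoinPair.insert_left [DecidableEq V] {T P : Finset V} (h : IsJoinPair G T P) {v t : V}
    (ht : t ∈ T) (hvt : ¬ G.Adj v t) (hv : ∀ p ∈ P, G.Adj v p) : IsJoinPair G (insert v T) P where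
  anticonnected_left := h.1.insert ht hvt
  anticonnected_right := h.2
  nontrivial_left := h.3.mono (Finset.subset_insert _ _)
  nontrivial_right := h.4
  adj x hx p hp := by
    rcases Finset.mem_insert.1 hx with rfl | hx
    · exact hv p hp
    · exact h.5 x hx p hp

/-- A vertex that is mixed on the left side of a join pair with maximal left side has no neighbors
on the right side. -/
theorem IsJoinPair.not_adj_of_isMixedOn {T P : Finset V} (h : IsJoinPair G T P) (hH : NoHouse G)
    (hmax : ∀ T', IsJoinPair G T' P → T'.card ≤ T.card) {v : V} (hv : IsMixedOn G T v) :
    ∀ p ∈ P, ¬ G.Adj v p := by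
  classical
  intro p hp hvp
  obtain ⟨t, ht, s, hs, hvt, hvs, hts⟩ := hv.exists_pair h.1
  -- A nonadjacent pair `p', q` of `P` split by `v` gives a house with cycle `q, t, p', s` and top
  -- `v`. If `v` is complete to `P`, it can be added to `T`.
  have hall : ∀ q ∈ P, G.Adj v q := by
    by_contra hnot
    push Not at hnot
    obtain ⟨p', hp', q, hq, h1, h2, h3⟩ := h.2 (fun q => G.Adj v q) ⟨p, hp, hvp⟩ hnot
    exact hH q t p' s v (h.5 t ht q hq).symm (h.5 t ht p' hp') (h.5 s hs p' hp').symm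
      (h.5 s hs q hq) hvt h1 (fun h => h3 h.symm) hts h2 hvs
  have := hmax _ (h.insert_left hs hvs hall)
  rw [Finset.card_insert_of_notMem hv.1] at this
  omega

/-- A vertex that is complete to the right side of a join pair with maximal left side belongs to
the left side or is complete to it. -/
theorem IsJoinPair.adj_of_complete {T P : Finset V} (h : IsJoinPair G T P)
    (hmax : ∀ T', IsJoinPair G T' P → T'.card ≤ T.card) {v : V} (hv : v ∉ T)
    (hP : ∀ p ∈ P, G.Adj v p) : ∀ t ∈ T, G.Adj v t := by
  classical
  intro t ht
  by_contra hvt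
  have := hmax _ (h.insert_left ht hvt hP)
  rw [Finset.card_insert_of_notMem hv] at this
  omega

/-- Vertices that are mixed on the two sides of a join pair, but have no neighbors on the other
side, are not adjacent. -/
theorem IsJoinPair.not_adj_of_isMixedOn_of_isMixedOn {T P : Finset V} (h : IsJoinPair G T P)
    (hP5 : NoPath5 G) {x y : V} (hx : IsMixedOn G T x) (hy : IsMixedOn G P y)
    (hxP : ∀ p ∈ P, ¬ G.Adj x p) (hyT : ∀ t ∈ T, ¬ G.Adj y t) : ¬ G.Adj x y := by
  intro hxy
  obtain ⟨t, ht, s, hs, hxt, hxs, hts⟩ := hx.exists_pair h.1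
  obtain ⟨-, -, q, hq, hyq⟩ := hy
  exact hP5 y x t q s hxy.symm hxt (h.5 t ht q hq) (h.5 s hs q hq).symm
    (hyT t ht) hyq (hyT s hs) (hxP q hq) hxs hts

/-- If all proper modules are cliques, both sides of a maximal join pair have mixed vertices. -/
theorem IsJoinPair.exists_isMixedOn {T P : Finset V} (h : IsJoinPair G T P)
    (hmod : ModulesAreCliques G) : ∃ v, IsMixedOn G T v := by
  by_contra hall
  push Not at hall
  obtain ⟨t, ht⟩ := h.nontrivial_left.nonempty
  obtain ⟨s, hs, hst, hadj⟩ := h.1.exists_not_adj h.3 ht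
  obtain ⟨p, hp⟩ := h.nontrivial_right.nonempty
  refine hadj (hmod {v | v ∈ T} ?_ ⟨p, fun hpT => h.disjoint hpT hp⟩ t ht s hs hst.symm)
  intro v hv a ha b hb hva
  by_contra hvb
  exact hall v ⟨hv, ⟨a, ha, hva⟩, b, hb, hvb⟩

/-- A join pair in which neither side can be enlarged, in a graph with all proper modules being
cliques, spans the graph together with its mixed vertices. -/
theorem IsJoinPair.cover {T P : Finset V} (h : IsJoinPair G T P) (hP5 : NoPath5 G)
    (hH : NoHouse G) (hB : NoBull G) (hmod : ModulesAreCliques G)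
    (hmaxT : ∀ T', IsJoinPair G T' P → T'.card ≤ T.card)
    (hmaxP : ∀ P', IsJoinPair G T P' → P'.card ≤ P.card) (v : V) :
    v ∈ T ∨ v ∈ P ∨ IsMixedOn G T v ∨ IsMixedOn G P v := by
  have hmaxP' : ∀ P', IsJoinPair G P' T → P'.card ≤ P.card := fun P' h' => hmaxP P' h'.symm
  have hXP : ∀ {x}, IsMixedOn G T x → ∀ p ∈ P, ¬ G.Adj x p :=
    fun hx => h.not_adj_of_isMixedOn hH hmaxT hx
  have hYT : ∀ {y}, IsMixedOn G P y → ∀ t ∈ T, ¬ G.Adj y t :=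
    fun hy => h.symm.not_adj_of_isMixedOn hH hmaxP' hy
  have hXY : ∀ {x y}, IsMixedOn G T x → IsMixedOn G P y → ¬ G.Adj x y :=
    fun hx hy => h.not_adj_of_isMixedOn_of_isMixedOn hP5 hx hy (hXP hx) (hYT hy)
  obtain ⟨x₀, hx₀⟩ := h.exists_isMixedOn hmod
  obtain ⟨y₀, hy₀⟩ := h.symm.exists_isMixedOn hmod
  obtain ⟨t₀, ht₀⟩ := h.nontrivial_left.nonempty
  obtain ⟨p₀, hp₀⟩ := h.nontrivial_right.nonempty
  by_contra hv
  let M : Set V := {v | v ∈ T ∨ v ∈ P ∨ IsMixedOn G T v ∨ IsMixedOn G P v}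
  obtain ⟨s, hs, hst, hadj⟩ := h.1.exists_not_adj h.3 ht₀
  -- The covered vertices would form a proper module that is not a clique.
  refine hadj (hmod M ?_ ⟨v, hv⟩ t₀ (Or.inl ht₀) s (Or.inl hs) hst.symm)
  intro z hz
  simp only [M, Set.mem_ofPred_eq, not_or] at hz
  obtain ⟨hzT, hzP, hzX, hzY⟩ := hz
  have hT : (∀ t ∈ T, G.Adj z t) ∨ ∀ t ∈ T, ¬ G.Adj z t := by
    by_contra hnot
    push Not at hnot
    exact hzX ⟨hzT, hnot.2, hnot.1⟩
  have hP : (∀ p ∈ P, G.Adj z p) ∨ ∀ p ∈ P, ¬ G.Adj z p := by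
    by_contra hnot
    push Not at hnot
    exact hzY ⟨hzP, hnot.2, hnot.1⟩
  by_cases hzt : G.Adj z t₀
  · have hT' : ∀ t ∈ T, G.Adj z t := hT.resolve_right fun h' => h' t₀ ht₀ hzt
    have hP' : ∀ p ∈ P, G.Adj z p := h.symm.adj_of_complete hmaxP' hzP hT'
    -- Now `z` is complete to `T ∪ P`. Bulls force `z` to be adjacent to one of `x, y`, and then to
    -- both.
    have hor : ∀ {x y}, IsMixedOn G T x → IsMixedOn G P y → G.Adj z x ∨ G.Adj z y := by
      intro x y hx hy
      by_contra hnot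
      push Not at hnot
      obtain ⟨-, ⟨t, ht, hxt⟩, -⟩ := id hx
      obtain ⟨-, ⟨p, hp, hyp⟩, -⟩ := id hy
      exact hB x t p y z hxt (h.5 t ht p hp) hyp.symm (hT' t ht) (hP' p hp) (hXP hx p hp)
        (hXY hx hy) (fun h' => hYT hy t ht h'.symm) hnot.1 hnot.2
    have hxy : ∀ {x y}, IsMixedOn G T x → IsMixedOn G P y → G.Adj z x → G.Adj z y := by
      intro x y hx hy hzx
      by_contra hzy
      obtain ⟨-, -, t, ht, hxt⟩ := id hx
      obtain ⟨-, ⟨p, hp, hyp⟩, -⟩ := id hy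
      exact hB x z p y t hzx.symm (hP' p hp) hyp.symm (hT' t ht).symm (h.5 t ht p hp)
        (hXP hx p hp) (hXY hx hy) hzy (fun h' => hxt h'.symm) fun h' => hYT hy t ht h'.symm
    have hyx : ∀ {x y}, IsMixedOn G T x → IsMixedOn G P y → G.Adj z y → G.Adj z x := by
      intro x y hx hy hzy
      by_contra hzx
      obtain ⟨-, -, p, hp, hyp⟩ := id hy
      obtain ⟨-, ⟨t, ht, hxt⟩, -⟩ := id hx
      exact hB y z t x p hzy.symm (hT' t ht) hxt.symm (hP' p hp).symm (h.5 t ht p hp).symm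
        (hYT hy t ht) (fun h' => hXY hx hy h'.symm) hzx (fun h' => hyp h'.symm)
        fun h' => hXP hx p hp h'.symm
    rintro a - b (hb | hb | hb | hb) -
    · exact hT' b hb
    · exact hP' b hb
    · exact (hor hb hy₀).elim id (hyx hb hy₀)
    · exact (hor hx₀ hb).elim (hxy hx₀ hb) id
  · have hT' : ∀ t ∈ T, ¬ G.Adj z t := hT.resolve_left fun h' => hzt (h' t₀ ht₀)
    have hP' : ∀ p ∈ P, ¬ G.Adj z p := hP.resolve_left fun h' =>
      hzt (h.adj_of_complete hmaxT hzT h' t₀ ht₀)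
    rintro a (ha | ha | ha | ha) b - hza
    · exact absurd hza (hT' a ha)
    · exact absurd hza (hP' a ha)
    · obtain ⟨t, ht, s, hs, hat, has, hts⟩ := ha.exists_pair h.1
      exact (hP5 z a t p₀ s hza hat (h.5 t ht p₀ hp₀) (h.5 s hs p₀ hp₀).symm (hT' t ht)
        (hP' p₀ hp₀) (hT' s hs) (hXP ha p₀ hp₀) has hts).elim
    · obtain ⟨p, hp, q, hq, hap, haq, hpq⟩ := ha.exists_pair h.2
      exact (hP5 z a p t₀ q hza hap (h.5 t₀ ht₀ p hp).symm (h.5 t₀ ht₀ q hq) (hP' p hp)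
        (hT' t₀ ht₀) (hP' q hq) (hYT ha t₀ ht₀) haq hpq).elim

theorem IsJoinPair.exists_simplicial [Finite V] {T₀ P₀ : Finset V} (h₀ : IsJoinPair G T₀ P₀)
    (hP5 : NoPath5 G) (hH : NoHouse G) (hB : NoBull G) (hC5 : NoCycle5 G)
    (hmod : ModulesAreCliques G) : ∃ u, IsSimplicial G u := by
  classical
  have := Fintype.ofFinite V
  -- a join pair with `P` as large as possible and then `T` as large as possible
  obtain ⟨T, P, h, hmaxP, hmaxT⟩ : ∃ T P, IsJoinPair G T P ∧
      (∀ T' P', IsJoinPair G T' P' → P'.card ≤ P.card) ∧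
      ∀ T', IsJoinPair G T' P → T'.card ≤ T.card := by
    have : Nonempty {q : Finset V × Finset V // IsJoinPair G q.1 q.2} := ⟨⟨(T₀, P₀), h₀⟩⟩
    obtain ⟨⟨⟨T₁, P⟩, h1⟩, hmax⟩ := Finite.exists_max
      fun q : {q : Finset V × Finset V // IsJoinPair G q.1 q.2} => q.1.2.card
    have : Nonempty {T : Finset V // IsJoinPair G T P} := ⟨⟨T₁, h1⟩⟩
    obtain ⟨⟨T, hT⟩, hmax'⟩ := Finite.exists_max
      fun T : {T : Finset V // IsJoinPair G T P} => T.1.card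
    exact ⟨T, P, hT, fun T' P' h' => hmax ⟨(T', P'), h'⟩, fun T' h' => hmax' ⟨T', h'⟩⟩
  have hcover := h.cover hP5 hH hB hmod hmaxT (hmaxP T)
  have hXP : ∀ {x}, IsMixedOn G T x → ∀ p ∈ P, ¬ G.Adj x p :=
    fun hx => h.not_adj_of_isMixedOn hH hmaxT hx
  have hYT : ∀ {y}, IsMixedOn G P y → ∀ t ∈ T, ¬ G.Adj y t :=
    fun hy => h.symm.not_adj_of_isMixedOn hH (fun P' h' => hmaxP T P' h'.symm) hy
  have hXY : ∀ {x y}, IsMixedOn G T x → IsMixedOn G P y → ¬ G.Adj x y :=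
    fun hx hy => h.not_adj_of_isMixedOn_of_isMixedOn hP5 hx hy (hXP hx) (hYT hy)
  obtain ⟨p, hp⟩ := h.nontrivial_right.nonempty
  -- For nonadjacent `t, s`, the sets `{t, s}` and `P ∪ {x}` would form a join pair with larger
  -- right side; this is why `P` is maximized over all pairs.
  have hclique : ∀ {x}, IsMixedOn G T x → ∀ t ∈ T, ∀ s ∈ T, G.Adj x t → G.Adj x s → t ≠ s →
      G.Adj t s := by
    intro x hx t ht s hs hxt hxs hne
    by_contra hts
    have hpair : IsJoinPair G {t, s} P :=
      ⟨isAnticonnected_pair hts, h.2, nontrivial_pair hne, h.4, by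
        intro r hr
        rcases Finset.mem_insert.1 hr with rfl | hr
        · exact h.5 r ht
        · rw [Finset.mem_singleton.1 hr]
          exact h.5 s hs⟩
    have hx' : ∀ r ∈ ({t, s} : Finset V), G.Adj x r := by
      intro r hr
      rcases Finset.mem_insert.1 hr with rfl | hr
      · exact hxt
      · rw [Finset.mem_singleton.1 hr]
        exact hxs
    have hle := hmaxP _ _ (hpair.symm.insert_left hp (hXP hx p hp) hx').symm
    rw [Finset.card_insert_of_notMem] at hle
    · omega
    · exact fun hxP => hx.2.2.elim fun r hr => hr.2 (h.5 r hr.1 x hxP).symm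
  -- adjacent mixed vertices have the same neighbors in `T`
  have hsame : ∀ {x x'}, IsMixedOn G T x → IsMixedOn G T x' → G.Adj x x' →
      ∀ t ∈ T, G.Adj x t → G.Adj x' t := by
    intro x x' hx hx' hxx t ht hxt
    by_contra hxt'
    -- A neighbor `s` of `x'` only gives a house or a 5-cycle. Otherwise a nonneighbor `s` of `t` in
    -- `T` is adjacent to neither `x` nor `x'`, and `x', x, t, p, s` is an induced path.
    by_cases hsub : ∃ s ∈ T, G.Adj x' s ∧ ¬ G.Adj x s
    · obtain ⟨s, hs, hx's, hxs⟩ := hsub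
      by_cases hts : G.Adj t s
      · exact hH x t s x' p hxt hts hx's.symm hxx.symm (h.5 t ht p hp).symm (h.5 s hs p hp).symm
          hxs (fun h' => hxt' h'.symm) (fun h' => hXP hx p hp h'.symm)
          fun h' => hXP hx' p hp h'.symm
      · exact hC5 x x' s p t hxx hx's (h.5 s hs p hp) (h.5 t ht p hp).symm hxt.symm hxs
          (hXP hx' p hp) (fun h' => hts h'.symm) (fun h' => hXP hx p hp h'.symm)
          fun h' => hxt' h'.symm
    · push Not at hsub
      obtain ⟨s, hs, hst, hts⟩ := h.1.exists_not_adj h.3 ht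
      have hxs : ¬ G.Adj x s := fun hxs => hts (hclique hx t ht s hs hxt hxs hst.symm)
      exact hP5 x' x t p s hxx.symm hxt (h.5 t ht p hp) (h.5 s hs p hp).symm hxt' (hXP hx' p hp)
        (fun h' => hxs (hsub s hs h')) (hXP hx p hp) hxs hts
  obtain ⟨x, hx⟩ := h.exists_isMixedOn hmod
  refine ⟨x, ?_⟩
  -- `K` is a proper module, hence a clique, and all neighbors of `x` lie in `T ∪ K`.
  let K : Set V := {y | IsMixedOn G T y ∧ ∀ t ∈ T, G.Adj x t ↔ G.Adj y t}
  have hKmod : IsModule G K := by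
    rintro v hv a ⟨ha, ha'⟩ b ⟨hb, hb'⟩ hva
    rcases hcover v with h1 | h1 | h1 | h1
    · exact ((hb' v h1).1 ((ha' v h1).2 hva.symm)).symm
    · exact absurd hva.symm (hXP ha v h1)
    · refine absurd ⟨h1, fun t ht => (ha' t ht).trans ⟨?_, ?_⟩⟩ hv
      · exact hsame ha h1 hva.symm t ht
      · exact hsame h1 ha hva t ht
    · exact absurd hva.symm (hXY ha h1)
  have hK : ∀ y ∈ K, ∀ z ∈ K, y ≠ z → G.Adj y z :=
    hmod K hKmod ⟨p, fun hpK => hpK.1.2.2.elim fun r hr => hr.2 (h.5 r hr.1 p hp).symm⟩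
  have hnbr : ∀ {y}, G.Adj x y → y ∈ T ∨ y ∈ K := by
    intro y hy
    rcases hcover y with h1 | h1 | h1 | h1
    · exact Or.inl h1
    · exact absurd hy (hXP hx y h1)
    · exact Or.inr ⟨h1, fun t ht => ⟨hsame hx h1 hy t ht, hsame h1 hx hy.symm t ht⟩⟩
    · exact absurd hy (hXY hx h1)
  intro y z hy hz hyz
  rcases hnbr hy with h1 | h1 <;> rcases hnbr hz with h2 | h2
  · exact hclique hx y h1 z h2 hy hz hyz
  · exact ((h2.2 y h1).1 hy).symm
  · exact (h1.2 z h2).1 hz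
  · exact hK y h1 z h2 hyz

/-- A nonempty graph without induced paths on five vertices, houses and bulls, in which every
proper module is a clique, has a simplicial vertex or no three independent vertices. -/
theorem exists_simplicial_or_noIndependentTriple [Finite V] [Nonempty V] (hP5 : NoPath5 G)
    (hH : NoHouse G) (hB : NoBull G) (hmod : ModulesAreCliques G) :
    (∃ u, IsSimplicial G u) ∨ NoIndependentTriple G := by
  classical
  by_cases hC5 : NoCycle5 G
  · left
    by_cases hC4 : ∀ a b c d, G.Adj a b → G.Adj b c → G.Adj c d → G.Adj d a →
        G.Adj a c ∨ G.Adj b d ∨ a = c ∨ b = d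
    · exact exists_simplicial_of_no_cycle4 hP5 hC5 hC4
    · push Not at hC4
      obtain ⟨a, b, c, d, hab, hbc, hcd, hda, hac, hbd, hac', hbd'⟩ := hC4
      have hpair : IsJoinPair G {a, c} {b, d} :=
        ⟨isAnticonnected_pair hac, isAnticonnected_pair hbd, nontrivial_pair hac',
          nontrivial_pair hbd', by simp [hab, hbc.symm, hcd, hda.symm]⟩
      exact hpair.exists_simplicial hP5 hH hB hC5 hmod
  · right
    unfold NoCycle5 at hC5
    push Not at hC5
    obtain ⟨a, b, c, d, e, h1, h2, h3, h4, h5, n1, n2, n3, n4, n5, -⟩ := hC5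
    have hc : IsInducedCycle5 G ![a, b, c, d, e] := by
      intro i
      fin_cases i
      · exact ⟨h1, n1⟩
      · exact ⟨h2, n2⟩
      · exact ⟨h3, n3⟩
      · exact ⟨h4, n4⟩
      · exact ⟨h5, n5⟩
    exact hc.noIndependentTriple hP5 hH hmod

/-! ### The class of graphs and the induction -/

/-- The graphs without induced path on five vertices, house and bull. -/
def IsPathHouseBullFree (G : SimpleGraph V) : Prop :=
  IsInducedFree G (SimpleGraph.pathGraph 5) ∧ IsInducedFree G house ∧ IsInducedFree G bull

theorem IsInducedFree.induce {W : Type*} {F : SimpleGraph W} (h : IsInducedFree G F) (s : Set V) :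
    IsInducedFree (G.induce s) F :=
  fun hF => h (hF.trans ⟨SimpleGraph.Embedding.induce s⟩)

theorem IsPathHouseBullFree.induce (h : IsPathHouseBullFree G) (s : Set V) :
    IsPathHouseBullFree (G.induce s) :=
  ⟨h.1.induce s, h.2.1.induce s, h.2.2.induce s⟩

theorem IsPathHouseBullFree.replaceByClique (h : IsPathHouseBullFree G) {M : Set V} {r : V}
    (hr : r ∈ M) (m : ℕ) : IsPathHouseBullFree (replaceByClique G M r m) :=
  ⟨h.1.replaceByClique not_hasTrueTwins_pathGraph hr,
    h.2.1.replaceByClique not_hasTrueTwins_house hr,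
    h.2.2.replaceByClique not_hasTrueTwins_bull hr⟩

/-- A finite graph that is not complete has a coloring with fewer colors than vertices. -/
theorem colorable_of_not_adj [Finite V] {x y : V} (hxy : x ≠ y) (hadj : ¬ G.Adj x y) :
    ∃ j < Nat.card V, G.Colorable j := by
  classical
  have := Fintype.ofFinite V
  let f : V → {v // v ≠ y} := fun v => if h : v = y then ⟨x, hxy⟩ else ⟨v, h⟩
  have c : G.Coloring {v // v ≠ y} := SimpleGraph.Coloring.mk f (by
    intro a b hab he
    have hv := congrArg Subtype.val he
    by_cases ha : a = y <;> by_cases hb : b = y <;> simp only [f, ha, hb, dif_pos, dif_neg,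
      not_false_iff] at hv
    · exact G.ne_of_adj hab (ha.trans hb.symm)
    · rw [ha, ← hv] at hab
      exact hadj hab.symm
    · rw [hb, hv] at hab
      exact hadj hab
    · exact G.ne_of_adj hab hv)
  refine ⟨_, ?_, c.colorable⟩
  rw [Nat.card_eq_fintype_card]
  exact Fintype.card_subtype_lt (x := y) (by simp)

theorem IsPathHouseBullFree.mixesAboveChromatic.{u} (n : ℕ) : ∀ {V : Type u} [Finite V]
    (G : SimpleGraph V), Nat.card V = n → IsPathHouseBullFree G → MixesAboveChromatic G := by
  induction n using Nat.strong_induction_on with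
  | _ n ih =>
    intro V _ G hV hG
    classical
    have := Fintype.ofFinite V
    have hinduce : ∀ s : Set V, (∃ v, v ∉ s) → Nat.card s < n := by
      rintro s ⟨v, hv⟩
      rw [← hV, Nat.card_coe_set_eq, ← Set.ncard_univ]
      exact Set.ncard_lt_ncard ⟨Set.subset_univ _, fun h => hv (h trivial)⟩
    by_cases hmod : ModulesAreCliques G
    · rcases isEmpty_or_nonempty V with hemp | hne
      · have : NoIndependentTriple G := fun a => isEmptyElim a
        exact this.mixesAboveChromatic
      · rcases exists_simplicial_or_noIndependentTriple (noPath5_of_isInducedFree hG.1)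
          (noHouse_of_isInducedFree hG.2.1) (noBull_of_isInducedFree hG.2.2) hmod with
          ⟨u, hu⟩ | h3
        · exact MixesAboveChromatic.of_simplicial hu
            (ih _ (hinduce {v | v ≠ u} ⟨u, fun h => h rfl⟩) _ rfl (hG.induce _))
        · exact h3.mixesAboveChromatic
    · unfold ModulesAreCliques at hmod
      push Not at hmod
      obtain ⟨M, hM, hout, x, hx, y, hy, hxy, hadj⟩ := hmod
      -- Two nonadjacent vertices of `M` can share a color, so the clique replacing `M` has fewer
      -- vertices than `M`.
      obtain ⟨j, hj, hcol⟩ := colorable_of_not_adj (G := G.induce M) (x := ⟨x, hx⟩) (y := ⟨y, hy⟩)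
        (fun h => hxy (congrArg Subtype.val h)) hadj
      have hex : ∃ m, (G.induce M).Colorable m := ⟨j, hcol⟩
      have hmj := Nat.find_min' hex hcol
      have hcard : Nat.card ({v // v ∉ M} ⊕ Fin (Nat.find hex)) < n := by
        rw [Nat.card_sum, Nat.card_fin]
        have h1 := Set.ncard_add_ncard_compl M
        rw [← Nat.card_coe_set_eq, ← Nat.card_coe_set_eq, hV] at h1
        change _ + Nat.card {v // v ∉ M} = n at h1
        omega
      exact MixesAboveChromatic.of_module hM hx (Nat.find_spec hex)
        (fun i hi => Nat.find_min' hex hi) (ih _ (hinduce M hout) _ rfl (hG.induce M))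
        (ih _ hcard _ rfl (hG.replaceByClique hx _))

end Recoloring

theorem theorem5 {V : Type*} [Finite V] (G : SimpleGraph V)
    (hP5 : Recoloring.IsInducedFree G (SimpleGraph.pathGraph 5))
    (hHouse : Recoloring.IsInducedFree G Recoloring.house)
    (hBull : Recoloring.IsInducedFree G Recoloring.bull) :
    Recoloring.IsRecolorable G :=
  Recoloring.isRecolorable_of_mixesAboveChromatic
    (Recoloring.IsPathHouseBullFree.mixesAboveChromatic _ G rfl ⟨hP5, hHouse, hBull⟩)
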